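/- **Setting.** Let $\mathcal V=\{1,\dots,N\}$, let $\mathcal X_0\subseteq\mathbb R^n$ be nonempty, closed and convex, and for each $i\in\mathcal V$ let $\Omega_i$ be a finite index set (the sets $\Omega_i$ may overlap). Put $$\mathcal X=\{x\in\mathcal X_0:\ g(x,\omega)\le 0\ \ \forall \omega\in\Omega_i,\ i\in\mathcal V\},\qquad f=\sum_{i\in\mathcal V}f_i,\qquad g^+=\max\{g,0\},$$ and assume that $\mathcal X^*=\operatorname{argmin}_{x\in\mathcal X}f(x)$ is nonempty. Let $\mathcal G_k=(\mathcal V,\mathcal E_k)$, $k\ge 0$, be digraphs with in-neighbourhoods $\mathcal N_{i,k}^{\rm in}=\{j:(j,i)\in\mathcal E_k\}\cup\{i\}$. Let $W_k$, $k\ge1$, be $N\times N$ matrices and $\{\alpha_k\}$ a nonnegative nonincreasing sequence. **Algorithm (DAP).** Start from $x_{i,0}\in\mathcal X_0$. For $k\ge1$ and $i\in\mathcal V$, $$p_{i,k}=\sum_{j\in\mathcal V}[W_k]_{ij}\,x_{j,k-1},\qquad v_{i,k}=\Pi_{\mathcal X_0}\big[p_{i,k}-\alpha_k s_{i,k}\big],\qquad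 x_{i,k}=\Pi_{\mathcal X_0}\Big[v_{i,k}-\frac{g^+(v_{i,k},\omega_{i,k})}{\|d_{i,k}\|^2}\,d_{i,k}\Big],$$ where $\Pi_{\mathcal X_0}$ is the Euclidean projection, $s_{i,k}\in\partial f_i(p_{i,k})$, $\omega_{i,k}\in\Omega_i$ is random, and $d_{i,k}\in\partial g^+(v_{i,k},\omega_{i,k})$ if $g^+(v_{i,k},\omega_{i,k})>0$, while the last step is omitted ($x_{i,k}=v_{i,k}$) if $g^+(v_{i,k},\omega_{i,k})=0$. The initial points and the choices of subgradients may be random but do not anticipate future samples: there is a filtration $(\mathcal F_k)_{k\ge0}$ such that $x_{i,k}$ is $\mathcal F_k$-measurable for $k\ge 0$, $\omega_{i,k}$ is $\mathcal F_k$-measurable for $k\ge 1$, and $(\omega_{i,k})_{i\in\mathcal V}$ is independent of $\mathcal F_{k-1}$ for $k\ge1$. **Assumptions.** 1. (Weights) There is $\nu\in(0,1)$ such that for all $k\ge1$ and $i,j\in\mathcal V$: $[W_k]_{ij}\ge\nu$ if $j\in\mathcal N_{i,k}^{\rm in}$ and $[W_k]_{ij}=0$ otherwise. Each $W_k$ is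 doubly stochastic. 2. (Functions) Each $f_i$, and each $g(\cdot,\omega)$ with $\omega\in\Omega_i$, $i\in\mathcal V$, is convex (not necessarily differentiable) on some open convex set containing $\mathcal X_0$. For each $i$ there is $C_{f_i}$ with $\|s\|\le C_{f_i}$ for all $x\in\mathcal X_0$, $s\in\partial f_i(x)$. There is $C_g$ with $\|d\|\le C_g$ for all $i\in\mathcal V$, $\omega\in\Omega_i$, $x\in\mathcal X_0$, $d\in\partial g^+(x,\omega)$. 3. (Sampling) For each $i$, the $\omega_{i,k}$, $k\ge1$, are i.i.d. with a distribution on $\Omega_i$ that gives positive probability to every element, and all $\omega_{i,k}$ ($i\in\mathcal V$, $k\ge1$) are independent. 4. (Global error bound) For each $i\in\mathcal V$ there is $c>0$ such that $\operatorname{dist}^2(x,\mathcal X)\le c\,\mathsf E\big[(g^+(x,\omega))^2\big]$ for all $x\in\mathcal X_0$, where the expectation is over $\omega\in\Omega_i$ drawn from agent $i$'s distribution. 5. ($Q$-strong connectivity) There is $Q$ such that for every $k\ge0$ the digraph $\big(\mathcal V,\bigcup_{\ell=0}^{Q-1}\mathcal E_{k+\ell}\big)$ is strongly connected. 6. (Stepsizes)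 $\sum_{k\ge1}\alpha_k=\infty$ and $\sum_{k\ge1}\alpha_k^2<\infty$. **Conclusion.** There is a random point $x^\star$ with values in $\mathcal X^*$ such that, almost surely, $\lim_{k\to\infty}x_{i,k}=x^\star$ for all $i\in\mathcal V$. -/

import Mathlib

open MeasureTheory ProbabilityTheory Filter Topology
open scoped BigOperators

namespace DAP

/-- `ℝⁿ` with the Euclidean norm. -/
abbrev Vec (n : ℕ) : Type := EuclideanSpace ℝ (Fin n)

/-! ### Convex analysis -/

/-- The subdifferential at `x` of a function `h` defined on the domain `U`. -/
def subdiff {n : ℕ} (U : Set (Vec n)) (h : Vec n → ℝ) (x : Vec n) : Set (Vec n) :=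
  {s | ∀ y ∈ U, h x + inner ℝ s (y - x) ≤ h y}

/-- `y` is the Euclidean projection of `z` on `X`, i.e. the point of `X` nearest to `z`
(it exists and is unique when `X` is nonempty, closed and convex). -/
def IsProj {n : ℕ} (X : Set (Vec n)) (z y : Vec n) : Prop :=
  y ∈ X ∧ ∀ w ∈ X, ‖y - z‖ ≤ ‖w - z‖

/-- The positive part `g⁺(x, j) = max {g(x, j), 0}` of the `j`-th constraint function. -/
def gplus {n : ℕ} {ι : Type*} (g : ι → Vec n → ℝ) (j : ι) (x : Vec n) : ℝ :=
  max (g j x) 0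

/-! ### The optimization problem -/

/-- The feasible set: the points of `X₀` that satisfy `g(x, j) ≤ 0` for every agent `i` and
every constraint index `j ∈ J i`. -/
def feasible {n N : ℕ} {ι : Type*} (X₀ : Set (Vec n)) (J : Fin N → Finset ι)
    (g : ι → Vec n → ℝ) : Set (Vec n) :=
  {x | x ∈ X₀ ∧ ∀ i, ∀ j ∈ J i, g j x ≤ 0}

/-- The set of minimizers of `∑ i, f i` over the feasible set. -/
def optimal {n N : ℕ} {ι : Type*} (X₀ : Set (Vec n)) (J : Fin N → Finset ι)
    (g : ι → Vec n → ℝ) (f : Fin N → Vec n → ℝ) : Set (Vec n) :=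
  {x | x ∈ feasible X₀ J g ∧ ∀ y ∈ feasible X₀ J g, ∑ i, f i x ≤ ∑ i, f i y}

/-- Standing assumptions on the common set, the objectives and the constraint functions.
`Uf i` and `Ug j` are the open sets containing `X₀` on which `f i` and `g j` are defined and
convex; the values of the functions elsewhere are never used. -/
structure ConvexData {n N : ℕ} {ι : Type*} (X₀ : Set (Vec n)) (J : Fin N → Finset ι)
    (Uf : Fin N → Set (Vec n)) (f : Fin N → Vec n → ℝ)
    (Ug : ι → Set (Vec n)) (g : ι → Vec n → ℝ) : Prop where
  nonempty : X₀.Nonempty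
  closed : IsClosed X₀
  convex : Convex ℝ X₀
  f_open : ∀ i, IsOpen (Uf i)
  f_subset : ∀ i, X₀ ⊆ Uf i
  f_convex : ∀ i, ConvexOn ℝ (Uf i) (f i)
  f_bounded : ∀ i, ∃ C : ℝ, ∀ x ∈ X₀, ∀ s ∈ subdiff (Uf i) (f i) x, ‖s‖ ≤ C
  g_open : ∀ i, ∀ j ∈ J i, IsOpen (Ug j)
  g_subset : ∀ i, ∀ j ∈ J i, X₀ ⊆ Ug j
  g_convex : ∀ i, ∀ j ∈ J i, ConvexOn ℝ (Ug j) (g j)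
  g_bounded : ∃ C : ℝ, ∀ i, ∀ j ∈ J i, ∀ x ∈ X₀,
    ∀ d ∈ subdiff (Ug j) (gplus g j) x, ‖d‖ ≤ C

/-- Global error bound: for every agent `i` the squared distance to the feasible set is
bounded on `X₀` by a multiple of the expectation of `g⁺(x, ·)²` under the sampling
distribution `π i` on `J i`. -/
def ErrorBound {n N : ℕ} {ι : Type*} (X₀ : Set (Vec n)) (J : Fin N → Finset ι)
    (g : ι → Vec n → ℝ) (π : Fin N → PMF ι) : Prop :=
  ∀ i, ∃ c : ℝ, 0 < c ∧ ∀ x ∈ X₀,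
    Metric.infDist x (feasible X₀ J g) ^ 2 ≤ c * ∑ j ∈ J i, (π i j).toReal * gplus g j x ^ 2

/-! ### Communication -/

/-- The in-neighbourhood of `i`: all `j` with a link from `j` to `i`, and `i` itself. -/
def inNbr {N : ℕ} (G : Digraph (Fin N)) (i : Fin N) : Set (Fin N) :=
  {j | G.Adj j i} ∪ {i}

/-- The weight matrices `W k`, `k ≥ 1`, respect the graphs `G k`, have entries on the
in-neighbourhoods bounded below by one positive constant, and are doubly stochastic. -/
structure DoublyStochasticWeights {N : ℕ} (G : ℕ → Digraph (Fin N))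
    (W : ℕ → Matrix (Fin N) (Fin N) ℝ) : Prop where
  nonneg : ∀ k, 1 ≤ k → ∀ i j, 0 ≤ W k i j
  eq_zero : ∀ k, 1 ≤ k → ∀ i j, j ∉ inNbr (G k) i → W k i j = 0
  lower : ∃ ν : ℝ, 0 < ν ∧ ν < 1 ∧ ∀ k, 1 ≤ k → ∀ i, ∀ j ∈ inNbr (G k) i, ν ≤ W k i j
  row_sum : ∀ k, 1 ≤ k → ∀ i, ∑ j, W k i j = 1
  col_sum : ∀ k, 1 ≤ k → ∀ j, ∑ i, W k i j = 1

/-- There is a window length `Q` such that, for every `k`, the union of the edge sets of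
`G k, …, G (k + Q - 1)` is strongly connected: a directed path leads from every vertex to
every other one. -/
def QStronglyConnected {N : ℕ} (G : ℕ → Digraph (Fin N)) : Prop :=
  ∃ Q : ℕ, ∀ k, ∀ a b : Fin N,
    Relation.ReflTransGen (fun u v => ∃ l, l < Q ∧ (G (k + l)).Adj u v) a b

/-! ### Random sampling of constraints -/

/-- The sampled constraint indices `idx i k`, `k ≥ 1`: values in `J i`, law `π i` giving
positive probability to exactly the elements of `J i`, all samples (over agents and times)
mutually independent, and each round of samples independent of the past `ℱ (k - 1)`. -/
structure Sampling {N : ℕ} {ι Ω : Type*} [MeasurableSpace ι] [mΩ : MeasurableSpace Ω]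
    (P : Measure Ω) (ℱ : Filtration ℕ mΩ) (J : Fin N → Finset ι) (π : Fin N → PMF ι)
    (idx : Fin N → ℕ → Ω → ι) : Prop where
  support : ∀ i, (π i).support = (J i : Set ι)
  mem : ∀ i k, 1 ≤ k → ∀ ω, idx i k ω ∈ J i
  adapted : ∀ i k, 1 ≤ k → Measurable[ℱ k] (idx i k)
  law : ∀ i k, 1 ≤ k → ∀ j ∈ J i, P (idx i k ⁻¹' {j}) = π i j
  indep : iIndepFun (fun q : Fin N × ℕ => idx q.1 (q.2 + 1)) P
  fresh : ∀ k, Indep (⨆ i, MeasurableSpace.comap (idx i (k + 1)) inferInstance) (ℱ k) P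

/-! ### The algorithm -/

/-- A run of the decentralized approximate projection algorithm: `x` are the iterates, started
in `X₀`; `p`, `v` are the intermediate points, `s` and `d` the chosen subgradients. The
recursion holds at every sample point. The history up to time `k` is `ℱ k`; the choices of
subgradients do not anticipate future samples, so `x i k` is determined by `ℱ k`.
The direction `d i k` is a subgradient of `g⁺` when the sampled constraint is violated, and is
arbitrary otherwise: the coefficient in front of it is then zero, and the last step does nothing. -/
structure IsRun {n N : ℕ} {ι Ω : Type*} [mΩ : MeasurableSpace Ω] (ℱ : Filtration ℕ mΩ)
    (X₀ : Set (Vec n))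
    (Uf : Fin N → Set (Vec n)) (f : Fin N → Vec n → ℝ)
    (Ug : ι → Set (Vec n)) (g : ι → Vec n → ℝ)
    (W : ℕ → Matrix (Fin N) (Fin N) ℝ) (α : ℕ → ℝ) (idx : Fin N → ℕ → Ω → ι)
    (x p v s d : Fin N → ℕ → Ω → Vec n) : Prop where
  init : ∀ i ω, x i 0 ω ∈ X₀
  adapted : ∀ i k, Measurable[ℱ k] (x i k)
  consensus : ∀ i k ω, p i (k + 1) ω = ∑ j, W (k + 1) i j • x j k ω
  subgrad_f : ∀ i k ω, s i (k + 1) ω ∈ subdiff (Uf i) (f i) (p i (k + 1) ω)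
  descent : ∀ i k ω,
    IsProj X₀ (p i (k + 1) ω - α (k + 1) • s i (k + 1) ω) (v i (k + 1) ω)
  subgrad_g : ∀ i k ω, 0 < gplus g (idx i (k + 1) ω) (v i (k + 1) ω) →
    d i (k + 1) ω ∈
      subdiff (Ug (idx i (k + 1) ω)) (gplus g (idx i (k + 1) ω)) (v i (k + 1) ω)
  approx_proj : ∀ i k ω,
    IsProj X₀
      (v i (k + 1) ω -
        (gplus g (idx i (k + 1) ω) (v i (k + 1) ω) / ‖d i (k + 1) ω‖ ^ 2) • d i (k + 1) ω)
      (x i (k + 1) ω)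

/-- Nonnegative nonincreasing stepsizes with `∑_{k ≥ 1} α k = ∞` and
`∑_{k ≥ 1} (α k)² < ∞`. -/
structure Stepsizes (α : ℕ → ℝ) : Prop where
  nonneg : ∀ k, 0 ≤ α k
  antitone : Antitone α
  sum_eq_top : Tendsto (fun m : ℕ => ∑ k ∈ Finset.Icc 1 m, α k) atTop atTop
  sum_sq : Summable (fun k : ℕ => α (k + 1) ^ 2)

end DAP

/-!
The proof separates one probabilistic estimate from a deterministic argument that runs along each
sample path.

For a feasible point `y`, a full step of an agent satisfies (`norm_sub_sq_le_of_step`)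
`‖x' - y‖² ≤ ‖p - y‖² - 2 α (f p - f y) + 2 C² α² - g⁺(p, ω)² / (2 K²)`,
where `p` is the average of the neighbours' states, `x'` the new state, and `C`, `K` bound the
subgradients of the `f i` and of `g⁺`. The violation is measured at `p` because `p` is a function
of the past, hence independent of the sample `ω`. The Lipschitz bounds behind this come from the
existence of subgradients (`subdiff_nonempty`).

*Probabilistic part* (`ae_summable_infDist_sq`). Let `y` be the feasible point nearest to `p` and
`D k` the sum of the squared distances of the states to the feasible set. Averaging does not
increase `D`, the term `α (f y - f p)` is at most `C α` times the distance, and Young's inequality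
with the error bound absorbs it into half of the mean violation. In expectation, therefore,
`D (k + 1) + E k / 2 ≤ D k + O(α²)`, where `E k` is a multiple of the mean violation, and summation
gives `∑ E k < ∞` almost surely. The initial states need not be integrable, so all expectations
carry the weight `(1 + D 0)⁻¹`, which is determined at time `0`. By the error bound the averages then have
square summable distances to the feasible set.

*Deterministic part* (`exists_tendsto_optimal`). On such a sample path the moves `x' - p` are square
summable. Products of weight matrices over a fixed number of steps have entries bounded below
(`exists_le_transition`), so they contract the diameter of the states, and the disagreement of the
agents is square summable as well (`summable_disagreement_sq`). Hence
`∑ i, ‖x i k - y‖²` converges for every optimal `y`, and the stepsizes times the optimality gaps,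
corrected for infeasibility, are summable. Since `∑ α k = ∞`, some cluster point `z` of the states is optimal. The sum
`∑ i, ‖x i k - z‖²` converges and tends to `0` along a subsequence, so it tends to `0`.
-/

namespace DAP

/-! ### Subgradients and projections -/

/-- A convex function on an open convex set has a subgradient at every point of it: separate
`(x, h x)` from the strict epigraph, which is open because `h` is continuous. -/
theorem subdiff_nonempty {n : ℕ} {U : Set (Vec n)} {h : Vec n → ℝ} (hU : IsOpen U)
    (hh : ConvexOn ℝ U h) {x : Vec n} (hx : x ∈ U) : (subdiff U h x).Nonempty := by
  have hopen : IsOpen {q : Vec n × ℝ | q.1 ∈ U ∧ h q.1 < q.2} := by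
    have hc : ContinuousOn (fun q : Vec n × ℝ => q.2 - h q.1) (Prod.fst ⁻¹' U) :=
      continuous_snd.continuousOn.sub
        ((hh.continuousOn hU).comp continuous_fst.continuousOn (fun _ hq => hq))
    have := hc.isOpen_inter_preimage (hU.preimage continuous_fst) (isOpen_Ioi (a := (0 : ℝ)))
    convert this using 1
    ext q
    simp
  obtain ⟨Λ, hΛ⟩ := geometric_hahn_banach_open_point hh.convex_strict_epigraph hopen
    (x := (x, h x)) (by simp)
  have hsplit : ∀ (y : Vec n) (t : ℝ), Λ (y, t) = Λ (y, 0) + t * Λ (0, 1) := by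
    intro y t
    rw [← smul_eq_mul, ← map_smul, ← map_add]
    simp
  have hβ : Λ (0, 1) < 0 := by
    have := hΛ (x, h x + 1) ⟨hx, by simp⟩
    rw [hsplit x (h x + 1), hsplit x (h x)] at this
    linarith
  refine ⟨(InnerProductSpace.toDual ℝ (Vec n)).symm
    ((-Λ (0, 1))⁻¹ • Λ.comp (ContinuousLinearMap.inl ℝ (Vec n) ℝ)), fun y hy => ?_⟩
  have hle : Λ (y, 0) + h y * Λ (0, 1) ≤ Λ (x, 0) + h x * Λ (0, 1) := by
    refine le_of_forall_pos_lt_add fun ε hε => ?_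
    have := hΛ (y, h y + ε / (-Λ (0, 1))) ⟨hy, lt_add_of_pos_right _ (by
      have : 0 < -Λ (0, 1) := by linarith
      positivity)⟩
    rw [hsplit y, hsplit x] at this
    have h3 : ε / (-Λ (0, 1)) * Λ (0, 1) = -ε := by
      rw [div_neg, neg_mul, div_mul_cancel₀ _ hβ.ne]
    nlinarith
  have hsub : Λ (y - x, 0) = Λ (y, 0) - Λ (x, 0) := by
    rw [← map_sub]; simp
  have hval : (-Λ (0, 1))⁻¹ * Λ (y - x, 0) ≤ h y - h x := by
    rw [inv_mul_le_iff₀ (by linarith), hsub]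
    linarith
  simp only [InnerProductSpace.toDual_symm_apply, _root_.smul_apply,
    ContinuousLinearMap.comp_apply, ContinuousLinearMap.inl_apply, smul_eq_mul]
  linarith

theorem sub_le_mul_norm_of_subdiff_bound {n : ℕ} {U : Set (Vec n)} {h : Vec n → ℝ}
    (hU : IsOpen U) (hh : ConvexOn ℝ U h) {x y : Vec n} (hx : x ∈ U) (hy : y ∈ U) {C : ℝ}
    (hC : ∀ s ∈ subdiff U h x, ‖s‖ ≤ C) : h x - h y ≤ C * ‖x - y‖ := by
  obtain ⟨s, hs⟩ := subdiff_nonempty hU hh hx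
  have h1 := hs y hy
  have h2 : -inner ℝ s (y - x) ≤ ‖s‖ * ‖x - y‖ := by
    rw [← inner_neg_right, neg_sub]
    exact real_inner_le_norm s (x - y)
  have h3 := mul_le_mul_of_nonneg_right (hC s hs) (norm_nonneg (x - y))
  linarith

theorem gplus_nonneg {n : ℕ} {ι : Type*} (g : ι → Vec n → ℝ) (j : ι) (x : Vec n) :
    0 ≤ gplus g j x := le_max_right _ _

theorem gplus_convexOn {n : ℕ} {ι : Type*} {g : ι → Vec n → ℝ} {j : ι} {U : Set (Vec n)}
    (h : ConvexOn ℝ U (g j)) : ConvexOn ℝ U (gplus g j) :=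
  h.sup (convexOn_const 0 h.1)

theorem IsProj.inner_le_zero {n : ℕ} {X : Set (Vec n)} (hX : Convex ℝ X) {z y w : Vec n}
    (h : IsProj X z y) (hw : w ∈ X) : inner ℝ (z - y) (w - y) ≤ 0 := by
  refine (norm_eq_iInf_iff_real_inner_le_zero hX h.1).1 ?_ w hw
  have : Nonempty X := ⟨⟨y, h.1⟩⟩
  refine le_antisymm (le_ciInf fun w => ?_) (ciInf_le ⟨0, ?_⟩ (⟨y, h.1⟩ : X))
  · rw [norm_sub_rev z y, norm_sub_rev z w]
    exact h.2 w w.2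
  · rintro _ ⟨w, rfl⟩
    exact norm_nonneg _

theorem IsProj.norm_sub_sq_le {n : ℕ} {X : Set (Vec n)} (hX : Convex ℝ X) {z y w : Vec n}
    (h : IsProj X z y) (hw : w ∈ X) : ‖y - w‖ ^ 2 ≤ ‖z - w‖ ^ 2 := by
  have h1 := h.inner_le_zero hX hw
  have h2 : ‖z - w‖ ^ 2 = ‖z - y‖ ^ 2 + 2 * inner ℝ (z - y) (y - w) + ‖y - w‖ ^ 2 := by
    rw [← norm_add_sq_real]; congr 2; abel
  have h3 : inner ℝ (z - y) (y - w) = -inner ℝ (z - y) (w - y) := by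
    rw [← inner_neg_right, neg_sub]
  nlinarith [sq_nonneg ‖z - y‖]

/-- The projected subgradient step: it moves towards `y` up to the error `α² C²`. -/
theorem IsProj.descent_norm_sub_sq_le {n : ℕ} {X : Set (Vec n)} (hX : Convex ℝ X)
    {p s v y : Vec n} {a C : ℝ} (h : IsProj X (p - a • s) v) (hs : ‖s‖ ≤ C) (hy : y ∈ X) :
    ‖v - y‖ ^ 2 ≤ ‖p - y‖ ^ 2 - 2 * a * inner ℝ s (p - y) + a ^ 2 * C ^ 2 := by
  have h1 := h.norm_sub_sq_le hX hy
  have h2 : ‖p - a • s - y‖ ^ 2 =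
      ‖p - y‖ ^ 2 - 2 * (a * inner ℝ s (p - y)) + a ^ 2 * ‖s‖ ^ 2 := by
    rw [show p - a • s - y = (p - y) - a • s by abel, norm_sub_sq_real, inner_smul_right,
      norm_smul, mul_pow, Real.norm_eq_abs, sq_abs, real_inner_comm]
  have h3 : a ^ 2 * ‖s‖ ^ 2 ≤ a ^ 2 * C ^ 2 := by gcongr
  linarith

/-- The approximate projection (a Polyak step for `g⁺` with target value `0`) moves towards every
point that satisfies the sampled constraint. -/
theorem IsProj.polyak_norm_sub_sq_le {n : ℕ} {ι : Type*} {X U : Set (Vec n)} (hX : Convex ℝ X)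
    {g : ι → Vec n → ℝ} {j : ι} {v d x y : Vec n} {C : ℝ}
    (h : IsProj X (v - (gplus g j v / ‖d‖ ^ 2) • d) x)
    (hd : 0 < gplus g j v → d ∈ subdiff U (gplus g j) v ∧ ‖d‖ ≤ C)
    (hy : y ∈ X) (hyU : y ∈ U) (hgy : gplus g j y = 0) :
    ‖x - y‖ ^ 2 ≤ ‖v - y‖ ^ 2 - gplus g j v ^ 2 / C ^ 2 := by
  have h1 := h.norm_sub_sq_le hX hy
  rcases (gplus_nonneg g j v).eq_or_lt with h0 | hpos
  · rw [← h0] at h1 ⊢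
    simpa using h1
  · obtain ⟨hds, hdC⟩ := hd hpos
    have h2 : gplus g j v ≤ inner ℝ d (v - y) := by
      have := hds y hyU
      rw [hgy, ← neg_sub v y, inner_neg_right] at this
      linarith
    have hd0 : 0 < ‖d‖ := by
      rw [norm_pos_iff]
      rintro rfl
      rw [inner_zero_left] at h2
      linarith
    have h3 : ‖v - (gplus g j v / ‖d‖ ^ 2) • d - y‖ ^ 2 =
        ‖v - y‖ ^ 2 - 2 * (gplus g j v / ‖d‖ ^ 2 * inner ℝ d (v - y)) +
          (gplus g j v / ‖d‖ ^ 2) ^ 2 * ‖d‖ ^ 2 := by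
      rw [show ∀ u : Vec n, v - u - y = (v - y) - u from fun u => by abel, norm_sub_sq_real,
        inner_smul_right, norm_smul, mul_pow, Real.norm_eq_abs, sq_abs, real_inner_comm]
    have h4 : (gplus g j v / ‖d‖ ^ 2) ^ 2 * ‖d‖ ^ 2 = gplus g j v ^ 2 / ‖d‖ ^ 2 := by
      field_simp
    have h5 : gplus g j v ^ 2 / ‖d‖ ^ 2 ≤ gplus g j v / ‖d‖ ^ 2 * inner ℝ d (v - y) := by
      rw [pow_two, mul_div_right_comm]
      gcongr
    have h6 : gplus g j v ^ 2 / C ^ 2 ≤ gplus g j v ^ 2 / ‖d‖ ^ 2 := by gcongr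
    linarith

/-- One full step of an agent, seen from a feasible point `y`. The gain is expressed by the
violation at `p` and not at `v`, because `p` is determined before the constraint is sampled
whereas `v`, through the choice of `s`, need not be. -/
theorem norm_sub_sq_le_of_step {n : ℕ} {ι : Type*} {X Uf U : Set (Vec n)} (hX : Convex ℝ X)
    {f : Vec n → ℝ} {g : ι → Vec n → ℝ} {j : ι} {p s v d x y : Vec n} {a C K : ℝ}
    (ha : 0 ≤ a) (hK : 0 < K) (hp : p ∈ X) (hy : y ∈ X) (hyf : y ∈ Uf) (hyU : y ∈ U)
    (hgy : gplus g j y = 0)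
    (hs : s ∈ subdiff Uf f p) (hsC : ‖s‖ ≤ C) (hv : IsProj X (p - a • s) v)
    (hd : 0 < gplus g j v → d ∈ subdiff U (gplus g j) v ∧ ‖d‖ ≤ K)
    (hlip : gplus g j p - gplus g j v ≤ K * ‖p - v‖)
    (hx : IsProj X (v - (gplus g j v / ‖d‖ ^ 2) • d) x) :
    ‖x - y‖ ^ 2 ≤ ‖p - y‖ ^ 2 - 2 * a * (f p - f y) + 2 * C ^ 2 * a ^ 2
      - 1 / (2 * K ^ 2) * gplus g j p ^ 2 := by
  have h1 := hx.polyak_norm_sub_sq_le hX hd hy hyU hgy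
  have h2 := hv.descent_norm_sub_sq_le hX hsC hy
  have h3 := hv.descent_norm_sub_sq_le hX hsC hp
  have h4 : a * (f p - f y) ≤ a * inner ℝ s (p - y) := by
    have := hs y hyf
    rw [← neg_sub p y, inner_neg_right] at this
    gcongr
    linarith
  have h5 : gplus g j p ^ 2 ≤ 2 * gplus g j v ^ 2 + 2 * (K ^ 2 * (a ^ 2 * C ^ 2)) := by
    have h6 : gplus g j p ≤ gplus g j v + K * ‖v - p‖ := by
      rw [norm_sub_rev]; linarith
    have h7 : gplus g j p ^ 2 ≤ (gplus g j v + K * ‖v - p‖) ^ 2 :=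
      pow_le_pow_left₀ (gplus_nonneg g j p) h6 2
    have h8 : ‖v - p‖ ^ 2 ≤ a ^ 2 * C ^ 2 := by simpa using h3
    have h9 : K ^ 2 * ‖v - p‖ ^ 2 ≤ K ^ 2 * (a ^ 2 * C ^ 2) := by gcongr
    nlinarith [sq_nonneg (gplus g j v - K * ‖v - p‖)]
  have h10 : 1 / (2 * K ^ 2) * gplus g j p ^ 2 ≤ gplus g j v ^ 2 / K ^ 2 + a ^ 2 * C ^ 2 := by
    calc 1 / (2 * K ^ 2) * gplus g j p ^ 2
        ≤ 1 / (2 * K ^ 2) * (2 * gplus g j v ^ 2 + 2 * (K ^ 2 * (a ^ 2 * C ^ 2))) := by gcongr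
      _ = gplus g j v ^ 2 / K ^ 2 + a ^ 2 * C ^ 2 := by field_simp
  linarith

/-! ### Consensus of perturbed averaging -/

/-- Square summability passes from the perturbation to the sequence in a contraction over windows
of `L` steps. -/
theorem summable_sq_of_window_contraction {u w : ℕ → ℝ} {ρ : ℝ} {L : ℕ} (hu : ∀ k, 0 ≤ u k)
    (hρ0 : 0 ≤ ρ) (hρ : ρ < 1) (h : ∀ k, u (k + L) ≤ ρ * u k + w k)
    (hw : Summable fun k => w k ^ 2) : Summable fun k => u k ^ 2 := by
  have hr : 0 < 1 - ρ := by linarith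
  -- Convexity of the square, with weights `ρ` and `1 - ρ`.
  have hsq : ∀ k, u (k + L) ^ 2 ≤ ρ * u k ^ 2 + (1 - ρ)⁻¹ * w k ^ 2 := by
    intro k
    have h1 : u (k + L) ^ 2 ≤ (ρ * u k + w k) ^ 2 := pow_le_pow_left₀ (hu _) (h k) 2
    have h2 : ρ * u k ^ 2 + (1 - ρ)⁻¹ * w k ^ 2 - (ρ * u k + w k) ^ 2 =
        ρ * (1 - ρ)⁻¹ * ((1 - ρ) * u k - w k) ^ 2 := by
      field_simp
      ring
    have h3 : 0 ≤ ρ * (1 - ρ)⁻¹ * ((1 - ρ) * u k - w k) ^ 2 := by positivity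
    linarith
  refine summable_of_sum_range_le (c := (1 - ρ)⁻¹ * ((∑ k ∈ Finset.range L, u k ^ 2) +
    (1 - ρ)⁻¹ * ∑' k, w k ^ 2)) (fun k => sq_nonneg _) fun M => ?_
  rw [le_inv_mul_iff₀ hr]
  have h1 : ∑ k ∈ Finset.range M, u k ^ 2 ≤ ∑ k ∈ Finset.range (L + M), u k ^ 2 :=
    Finset.sum_le_sum_of_subset_of_nonneg (by intro k; simp; omega) (fun _ _ _ => sq_nonneg _)
  rw [Finset.sum_range_add] at h1
  have h2 : ∑ k ∈ Finset.range M, u (L + k) ^ 2 ≤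
      ρ * ∑ k ∈ Finset.range M, u k ^ 2 + (1 - ρ)⁻¹ * ∑ k ∈ Finset.range M, w k ^ 2 := by
    rw [Finset.mul_sum, Finset.mul_sum, ← Finset.sum_add_distrib]
    exact Finset.sum_le_sum fun k _ => by rw [add_comm L k]; exact hsq k
  have h3 : (1 - ρ)⁻¹ * ∑ k ∈ Finset.range M, w k ^ 2 ≤ (1 - ρ)⁻¹ * ∑' k, w k ^ 2 :=
    mul_le_mul_of_nonneg_left (hw.sum_le_tsum _ (fun _ _ => sq_nonneg _)) (by positivity)
  linarith

/-- The product `W (k + m) ⋯ W (k + 1)` that transports the states at time `k` to time `k + m`. -/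
def transition {N : ℕ} (W : ℕ → Matrix (Fin N) (Fin N) ℝ) (k : ℕ) :
    ℕ → Matrix (Fin N) (Fin N) ℝ
  | 0 => 1
  | m + 1 => W (k + m + 1) * transition W k m

section Transition

variable {N : ℕ} {G : ℕ → Digraph (Fin N)} {W : ℕ → Matrix (Fin N) (Fin N) ℝ}

theorem transition_nonneg (hW : DoublyStochasticWeights G W) (k m : ℕ) (i j : Fin N) :
    0 ≤ transition W k m i j := by
  induction m generalizing i with
  | zero =>
    simp only [transition, Matrix.one_apply]
    split_ifs <;> norm_num
  | succ m ih =>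
    rw [transition, Matrix.mul_apply]
    exact Finset.sum_nonneg fun l _ => mul_nonneg (hW.nonneg _ (by omega) _ _) (ih l)

theorem transition_row_sum (hW : DoublyStochasticWeights G W) (k m : ℕ) (i : Fin N) :
    ∑ j, transition W k m i j = 1 := by
  induction m generalizing i with
  | zero => simp [transition, Matrix.one_apply]
  | succ m ih =>
    simp only [transition, Matrix.mul_apply]
    rw [Finset.sum_comm]
    simp only [← Finset.mul_sum, ih, mul_one]
    exact hW.row_sum _ (by omega) i

theorem pow_le_transition_succ (hW : DoublyStochasticWeights G W) {ν : ℝ} (hν : 0 < ν)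
    (hlow : ∀ k, 1 ≤ k → ∀ i, ∀ j ∈ inNbr (G k) i, ν ≤ W k i j) {k m : ℕ} {u v a : Fin N}
    (hu : ν ^ m ≤ transition W k m u a) (huv : u ∈ inNbr (G (k + m + 1)) v) :
    ν ^ (m + 1) ≤ transition W k (m + 1) v a := by
  rw [transition, Matrix.mul_apply]
  calc ν ^ (m + 1) = ν * ν ^ m := pow_succ' ν m
    _ ≤ W (k + m + 1) v u * transition W k m u a :=
      mul_le_mul (hlow _ (by omega) v u huv) hu (by positivity)
        (hW.nonneg _ (by omega) v u)
    _ ≤ _ := Finset.single_le_sum (f := fun l => W (k + m + 1) v l * transition W k m l a)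
      (fun l _ => mul_nonneg (hW.nonneg _ (by omega) _ _) (transition_nonneg hW k m l a))
      (Finset.mem_univ u)

/-- Over a fixed number of steps every agent influences every other one by a definite amount: in
each window of `Q` steps the set of agents reached from `a` either is everything or grows. -/
theorem exists_le_transition (hW : DoublyStochasticWeights G W) (hG : QStronglyConnected G) :
    ∃ (L : ℕ) (η : ℝ), 0 < η ∧ η < 1 ∧ ∀ k i j, η ≤ transition W k L i j := by
  classical
  obtain ⟨Q, hQ⟩ := hG
  obtain ⟨ν, hν, -, hlow⟩ := hW.lower
  let S : ℕ → ℕ → Fin N → Finset (Fin N) := fun k m a =>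
    Finset.univ.filter fun i => ν ^ m ≤ transition W k m i a
  have hSmem : ∀ k m a i, i ∈ S k m a ↔ ν ^ m ≤ transition W k m i a := by simp [S]
  have hmono : ∀ k a m l, S k m a ⊆ S k (m + l) a := by
    intro k a m l
    induction l with
    | zero => simp
    | succ l ih =>
      intro i hi
      have := ih hi
      rw [hSmem] at this ⊢
      exact pow_le_transition_succ hW hν hlow this (Or.inr rfl)
  have hgrow : ∀ k a r, r < (S k (r * Q) a).card ∨ S k (r * Q) a = Finset.univ := by
    intro k a r
    induction r with
    | zero =>
      left
      rw [Finset.card_pos]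
      exact ⟨a, by simp [S, transition]⟩
    | succ r ih =>
      have hsub : S k (r * Q) a ⊆ S k ((r + 1) * Q) a := by
        rw [add_one_mul]; exact hmono k a _ _
      by_cases hall : S k (r * Q) a = Finset.univ
      · right
        rw [hall] at hsub
        exact Finset.univ_subset_iff.1 hsub
      left
      have hcard := ih.resolve_right hall
      obtain ⟨b, hb⟩ : ∃ b, b ∉ S k (r * Q) a := by
        by_contra hcon
        push Not at hcon
        exact hall (Finset.eq_univ_iff_forall.2 hcon)
      obtain ⟨c, hc⟩ : (S k (r * Q) a).Nonempty := Finset.card_pos.1 (by omega)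
      -- A path from inside to outside leaves the set along some edge.
      obtain ⟨u, v, hu, hv, l, hl, huv⟩ : ∃ u v, u ∈ S k (r * Q) a ∧ v ∉ S k (r * Q) a ∧
          ∃ l, l < Q ∧ (G (k + r * Q + 1 + l)).Adj u v := by
        by_contra hcon
        push Not at hcon
        have : ∀ b, Relation.ReflTransGen
            (fun u v => ∃ l, l < Q ∧ (G (k + r * Q + 1 + l)).Adj u v) c b →
              b ∈ S k (r * Q) a := by
          intro b hcb
          induction hcb with
          | refl => exact hc
          | tail _ hstep ih =>
            obtain ⟨l, hl, hadj⟩ := hstep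
            by_contra hnot
            exact hcon _ _ ih hnot l hl hadj
        exact hb (this b (hQ _ c b))
      have hv' : v ∈ S k ((r + 1) * Q) a := by
        have h1 : v ∈ S k (r * Q + l + 1) a := by
          rw [hSmem]
          refine pow_le_transition_succ hW hν hlow
            ((hSmem _ _ _ _).1 (hmono k a _ l hu)) (Or.inl ?_)
          rw [← add_assoc, add_right_comm]
          exact huv
        have h2 : (r + 1) * Q = r * Q + l + 1 + (Q - (l + 1)) := by
          rw [add_one_mul]; omega
        rw [h2]
        exact hmono k a _ _ h1
      have : (insert v (S k (r * Q) a)).card ≤ (S k ((r + 1) * Q) a).card :=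
        Finset.card_le_card (Finset.insert_subset hv' hsub)
      rw [Finset.card_insert_of_notMem hv] at this
      omega
  refine ⟨N * Q, min (ν ^ (N * Q)) (1 / 2), by positivity,
    (min_le_right _ _).trans_lt (by norm_num), fun k i j => (min_le_left _ _).trans ?_⟩
  have huniv : S k (N * Q) j = Finset.univ := by
    refine (hgrow k j N).resolve_left fun h => ?_
    have := Finset.card_le_univ (S k (N * Q) j)
    simp at this
    omega
  rw [← hSmem, huniv]
  exact Finset.mem_univ i

end Transition

/-- A stochastic matrix with entries at least `η` contracts the diameter of a family of points by
the factor `1 - η`. -/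
theorem norm_sum_sub_sum_le {N : ℕ} {E : Type*} [NormedAddCommGroup E] [NormedSpace ℝ E]
    {Φ : Matrix (Fin N) (Fin N) ℝ} {η B : ℝ} (hη : η < 1)
    (hlow : ∀ i j, η ≤ Φ i j) (h0 : ∀ i j, 0 ≤ Φ i j) (hrow : ∀ i, ∑ j, Φ i j = 1) {x : Fin N → E}
    (hB : ∀ i j, ‖x i - x j‖ ≤ B) (i j : Fin N) :
    ‖∑ a, Φ i a • x a - ∑ b, Φ j b • x b‖ ≤ (1 - η) * B := by
  -- Take the mass `η` off the column `i`, which both averages share.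
  let R : Fin N → Fin N → ℝ := fun l a => Φ l a - if a = i then η else 0
  have hR0 : ∀ l a, 0 ≤ R l a := by
    intro l a
    simp only [R]
    split_ifs
    · linarith [hlow l a]
    · linarith [h0 l a]
  have hRsum : ∀ l, ∑ a, R l a = 1 - η := by
    intro l
    simp [R, Finset.sum_sub_distrib, hrow]
  have hRx : ∀ l, ∑ a, Φ l a • x a = ∑ a, R l a • x a + η • x i := by
    intro l
    simp [R, sub_smul, Finset.sum_sub_distrib, ite_smul]
  have hr : 0 < 1 - η := by linarith
  have key : (1 - η) • (∑ a, Φ i a • x a - ∑ b, Φ j b • x b) =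
      ∑ a, ∑ b, (R i a * R j b) • (x a - x b) := by
    rw [hRx i, hRx j, add_sub_add_right_eq_sub, smul_sub]
    simp only [smul_sub, Finset.sum_sub_distrib]
    congr 1
    · rw [← hRsum j, Finset.sum_smul, Finset.sum_comm]
      refine Finset.sum_congr rfl fun b _ => ?_
      rw [Finset.smul_sum]
      exact Finset.sum_congr rfl fun a _ => by rw [smul_smul, mul_comm]
    · rw [← hRsum i, Finset.sum_smul]
      refine Finset.sum_congr rfl fun a _ => ?_
      rw [Finset.smul_sum]
      exact Finset.sum_congr rfl fun b _ => by rw [smul_smul]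
  have hbound : ‖(1 - η) • (∑ a, Φ i a • x a - ∑ b, Φ j b • x b)‖ ≤ (1 - η) * ((1 - η) * B) := by
    rw [key]
    calc ‖∑ a, ∑ b, (R i a * R j b) • (x a - x b)‖
        ≤ ∑ a, ∑ b, (R i a * R j b) * B := by
          refine norm_sum_le_of_le _ fun a _ => norm_sum_le_of_le _ fun b _ => ?_
          rw [norm_smul, Real.norm_of_nonneg (mul_nonneg (hR0 i a) (hR0 j b))]
          exact mul_le_mul_of_nonneg_left (hB a b) (mul_nonneg (hR0 i a) (hR0 j b))
      _ = (1 - η) * ((1 - η) * B) := by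
          simp only [← Finset.sum_mul, ← Finset.mul_sum, hRsum]
          ring
  rw [norm_smul, Real.norm_of_nonneg hr.le] at hbound
  exact le_of_mul_le_mul_left hbound hr

section Consensus

variable {N : ℕ} {E : Type*} [NormedAddCommGroup E]
  {G : ℕ → Digraph (Fin N)} {W : ℕ → Matrix (Fin N) (Fin N) ℝ} {x e : Fin N → ℕ → E}

/-- The diameter of the family of states at time `k`. -/
noncomputable def disagreement (x : Fin N → ℕ → E) (k : ℕ) : ℝ :=
  ‖fun q : Fin N × Fin N => x q.1 k - x q.2 k‖

theorem disagreement_nonneg (x : Fin N → ℕ → E) (k : ℕ) : 0 ≤ disagreement x k := norm_nonneg _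

theorem norm_sub_le_disagreement (x : Fin N → ℕ → E) (k : ℕ) (i j : Fin N) :
    ‖x i k - x j k‖ ≤ disagreement x k :=
  norm_le_pi_norm (fun q : Fin N × Fin N => x q.1 k - x q.2 k) (i, j)

variable [NormedSpace ℝ E]

theorem norm_sub_transition_le (hW : DoublyStochasticWeights G W)
    (hx : ∀ i k, x i (k + 1) = ∑ j, W (k + 1) i j • x j k + e i (k + 1)) (k m : ℕ) (i : Fin N) :
    ‖x i (k + m) - ∑ j, transition W k m i j • x j k‖ ≤
      ∑ l ∈ Finset.range m, ‖fun i => e i (k + l + 1)‖ := by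
  induction m generalizing i with
  | zero => simp [transition, Matrix.one_apply, ite_smul]
  | succ m ih =>
    have hsplit : x i (k + (m + 1)) - ∑ j, transition W k (m + 1) i j • x j k =
        ∑ l, W (k + m + 1) i l • (x l (k + m) - ∑ j, transition W k m l j • x j k)
          + e i (k + m + 1) := by
      rw [← add_assoc, hx, transition]
      simp only [Matrix.mul_apply, Finset.sum_smul, smul_sub, Finset.sum_sub_distrib,
        Finset.smul_sum, smul_smul]
      rw [Finset.sum_comm (s := Finset.univ) (t := Finset.univ)
        (f := fun j l => (W (k + m + 1) i l * transition W k m l j) • x j k)]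
      abel
    rw [hsplit, Finset.sum_range_succ]
    refine (norm_add_le _ _).trans (add_le_add ?_ (norm_le_pi_norm (fun i => e i (k + m + 1)) i))
    calc ‖∑ l, W (k + m + 1) i l • (x l (k + m) - ∑ j, transition W k m l j • x j k)‖
        ≤ ∑ l, W (k + m + 1) i l * ∑ l ∈ Finset.range m, ‖fun i => e i (k + l + 1)‖ := by
          refine norm_sum_le_of_le _ fun l _ => ?_
          rw [norm_smul, Real.norm_of_nonneg (hW.nonneg _ (by omega) _ _)]
          exact mul_le_mul_of_nonneg_left (ih l) (hW.nonneg _ (by omega) _ _)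
      _ = _ := by rw [← Finset.sum_mul, hW.row_sum _ (by omega), one_mul]

/-- Averaging with square summable perturbations: the disagreement is square summable. -/
theorem summable_disagreement_sq (hW : DoublyStochasticWeights G W) (hG : QStronglyConnected G)
    (hx : ∀ i k, x i (k + 1) = ∑ j, W (k + 1) i j • x j k + e i (k + 1))
    (he : ∀ i, Summable fun k => ‖e i (k + 1)‖ ^ 2) :
    Summable fun k => disagreement x k ^ 2 := by
  obtain ⟨L, η, hη0, hη1, hη⟩ := exists_le_transition hW hG
  let ε : ℕ → ℝ := fun k => ‖fun i => e i (k + 1)‖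
  have hε : Summable fun k => ε k ^ 2 := by
    refine Summable.of_nonneg_of_le (fun _ => sq_nonneg _) (fun k => ?_)
      (summable_sum (s := Finset.univ) fun i _ => he i)
    have hnn : 0 ≤ ∑ i, ‖e i (k + 1)‖ ^ 2 := Finset.sum_nonneg fun _ _ => sq_nonneg _
    rw [← Real.le_sqrt (norm_nonneg _) hnn, pi_norm_le_iff_of_nonneg (Real.sqrt_nonneg _)]
    exact fun i => Real.le_sqrt_of_sq_le
      (Finset.single_le_sum (f := fun i => ‖e i (k + 1)‖ ^ 2) (fun _ _ => sq_nonneg _)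
        (Finset.mem_univ i))
  refine summable_sq_of_window_contraction (ρ := 1 - η) (L := L)
    (w := fun k => 2 * ∑ l ∈ Finset.range L, ε (k + l)) (disagreement_nonneg x)
    (by linarith) (by linarith) (fun k => ?_) ?_
  · have hρB : 0 ≤ (1 - η) * disagreement x k :=
      mul_nonneg (by linarith) (disagreement_nonneg x k)
    refine (pi_norm_le_iff_of_nonneg (add_nonneg hρB (by positivity))).2 fun q => ?_
    have h1 := norm_sub_transition_le hW hx k L q.1
    have h2 := norm_sub_transition_le hW hx k L q.2
    have h3 := norm_sum_sub_sum_le hη1 (hη k) (transition_nonneg hW k L)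
      (transition_row_sum hW k L) (x := fun i => x i k) (norm_sub_le_disagreement x k) q.1 q.2
    have h4 : x q.1 (k + L) - x q.2 (k + L) =
        (x q.1 (k + L) - ∑ j, transition W k L q.1 j • x j k)
        - (x q.2 (k + L) - ∑ j, transition W k L q.2 j • x j k)
        + (∑ j, transition W k L q.1 j • x j k - ∑ j, transition W k L q.2 j • x j k) := by abel
    rw [h4]
    refine (norm_add_le _ _).trans ?_
    have h5 := norm_sub_le (x q.1 (k + L) - ∑ j, transition W k L q.1 j • x j k)
      (x q.2 (k + L) - ∑ j, transition W k L q.2 j • x j k)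
    simp only [ε]
    linarith
  · refine Summable.of_nonneg_of_le (fun _ => sq_nonneg _) (fun k => ?_)
      (Summable.mul_left (4 * (L : ℝ)) (summable_sum (s := Finset.range L)
        fun l _ => (summable_nat_add_iff l).2 hε))
    have := sq_sum_le_card_mul_sum_sq (s := Finset.range L) (f := fun l => ε (k + l))
    rw [Finset.card_range] at this
    rw [mul_pow]
    linarith

end Consensus

/-! ### Averaging and distances -/

theorem sum_norm_sq_average_le {N : ℕ} {G : ℕ → Digraph (Fin N)}
    {W : ℕ → Matrix (Fin N) (Fin N) ℝ} (hW : DoublyStochasticWeights G W) {E : Type*}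
    [NormedAddCommGroup E] [NormedSpace ℝ E] (k : ℕ) (z : Fin N → E) :
    ∑ i, ‖∑ j, W (k + 1) i j • z j‖ ^ 2 ≤ ∑ j, ‖z j‖ ^ 2 := by
  have hconv : ConvexOn ℝ Set.univ (fun z : E => ‖z‖ ^ 2) :=
    (convexOn_norm convex_univ).pow (fun _ _ => norm_nonneg _) 2
  calc ∑ i, ‖∑ j, W (k + 1) i j • z j‖ ^ 2
      ≤ ∑ i, ∑ j, W (k + 1) i j * ‖z j‖ ^ 2 := Finset.sum_le_sum fun i _ => by
        have := hconv.map_sum_le (t := Finset.univ) (w := fun j => W (k + 1) i j) (p := z)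
          (fun j _ => hW.nonneg _ (by omega) i j) (hW.row_sum _ (by omega) i)
          (fun _ _ => Set.mem_univ _)
        simpa using this
    _ = ∑ j, ‖z j‖ ^ 2 := by
        rw [Finset.sum_comm]
        simp only [← Finset.sum_mul, hW.col_sum (k + 1) (by omega), one_mul]

theorem average_sub_average {N : ℕ} {G : ℕ → Digraph (Fin N)} {E : Type*}
    [NormedAddCommGroup E] [NormedSpace ℝ E]
    {W : ℕ → Matrix (Fin N) (Fin N) ℝ} (hW : DoublyStochasticWeights G W)
    (k : ℕ) (i : Fin N) (z : Fin N → E) (y : E) :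
    ∑ j, W (k + 1) i j • z j - y = ∑ j, W (k + 1) i j • (z j - y) := by
  simp only [smul_sub, Finset.sum_sub_distrib]
  rw [← Finset.sum_smul, hW.row_sum _ (by omega), one_smul]

theorem average_mem {N : ℕ} {G : ℕ → Digraph (Fin N)} {n : ℕ}
    {W : ℕ → Matrix (Fin N) (Fin N) ℝ} (hW : DoublyStochasticWeights G W) {X : Set (Vec n)}
    (hX : Convex ℝ X) (k : ℕ) (i : Fin N) {z : Fin N → Vec n} (hz : ∀ j, z j ∈ X) :
    ∑ j, W (k + 1) i j • z j ∈ X :=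
  hX.sum_mem (fun j _ => hW.nonneg _ (by omega) i j) (hW.row_sum _ (by omega) i)
    (fun j _ => hz j)

/-- Averaging does not increase the sum of the squared distances to a convex set. -/
theorem sum_infDist_sq_average_le {N : ℕ} {G : ℕ → Digraph (Fin N)} {n : ℕ}
    {W : ℕ → Matrix (Fin N) (Fin N) ℝ} (hW : DoublyStochasticWeights G W) {X : Set (Vec n)}
    (hX : Convex ℝ X) (hcl : IsClosed X) (hne : X.Nonempty) (k : ℕ) (z : Fin N → Vec n) :
    ∑ i, Metric.infDist (∑ j, W (k + 1) i j • z j) X ^ 2 ≤ ∑ j, Metric.infDist (z j) X ^ 2 := by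
  choose y hyX hy using fun j => hcl.exists_infDist_eq_dist hne (z j)
  calc ∑ i, Metric.infDist (∑ j, W (k + 1) i j • z j) X ^ 2
      ≤ ∑ i, ‖∑ j, W (k + 1) i j • (z j - y j)‖ ^ 2 := Finset.sum_le_sum fun i _ => by
        refine pow_le_pow_left₀ Metric.infDist_nonneg ?_ 2
        refine (Metric.infDist_le_dist_of_mem (average_mem hW hX k i hyX)).trans_eq ?_
        rw [dist_eq_norm, ← Finset.sum_sub_distrib]
        simp only [smul_sub]
    _ ≤ ∑ j, ‖z j - y j‖ ^ 2 := sum_norm_sq_average_le hW k _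
    _ = _ := by simp only [hy, dist_eq_norm]

/-! ### Convergence of a single trajectory -/

/-- A nonnegative sequence with summable increases converges, and its decreases are summable. -/
theorem tendsto_and_summable_of_le_sub_add {u b c : ℕ → ℝ} (hu : ∀ k, 0 ≤ u k)
    (hb : ∀ k, 0 ≤ b k) (hc : ∀ k, 0 ≤ c k) (hbs : Summable b)
    (h : ∀ k, u (k + 1) ≤ u k - c k + b k) :
    (∃ l, Tendsto u atTop (𝓝 l)) ∧ Summable c := by
  have hB : ∀ m, ∑ k ∈ Finset.range m, b k ≤ ∑' k, b k := fun m =>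
    hbs.sum_le_tsum _ fun k _ => hb k
  constructor
  · have hanti : Antitone fun m => u m - ∑ k ∈ Finset.range m, b k := by
      refine antitone_nat_of_succ_le fun m => ?_
      rw [Finset.sum_range_succ]
      linarith [h m, hc m]
    have hlim := tendsto_atTop_ciInf hanti ⟨-∑' k, b k, by
      rintro _ ⟨m, rfl⟩
      simp only
      linarith [hu m, hB m]⟩
    refine ⟨_, (hlim.add hbs.hasSum.tendsto_sum_nat).congr fun m => by ring⟩
  · have hsum : ∀ m, u m + ∑ k ∈ Finset.range m, c k ≤ u 0 + ∑ k ∈ Finset.range m, b k := by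
      intro m
      induction m with
      | zero => simp
      | succ m ih =>
        rw [Finset.sum_range_succ, Finset.sum_range_succ]
        linarith [h m]
    exact summable_of_sum_range_le (c := u 0 + ∑' k, b k) hc fun m => by
      linarith [hsum m, hu m, hB m]

/-- If `∑ α k = ∞` and `∑ α k a k < ∞` then `a` tends to `0` along a subsequence. -/
theorem exists_subseq_tendsto_zero {α a : ℕ → ℝ} (hα : ∀ k, 0 ≤ α k) (ha : ∀ k, 0 ≤ a k)
    (hdiv : ¬ Summable α) (hs : Summable fun k => α k * a k) :
    ∃ φ : ℕ → ℕ, StrictMono φ ∧ Tendsto (fun m => a (φ m)) atTop (𝓝 0) := by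
  have hfreq : ∀ m : ℕ, ∃ᶠ k in atTop, a k < 1 / ((m : ℝ) + 1) := by
    intro m hcon
    simp only [not_lt] at hcon
    obtain ⟨K, hK⟩ := eventually_atTop.1 hcon
    refine hdiv ((summable_nat_add_iff K).1 ?_)
    refine Summable.of_nonneg_of_le (fun k => hα _) (fun k => ?_)
      (((summable_nat_add_iff K).2 hs).mul_left ((m : ℝ) + 1))
    have h1 := hK (k + K) (by omega)
    have hm : (0 : ℝ) < m + 1 := by positivity
    rw [div_le_iff₀ hm] at h1
    nlinarith [mul_le_mul_of_nonneg_left h1 (hα (k + K))]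
  obtain ⟨φ, hφ, hlt⟩ := extraction_forall_of_frequently hfreq
  exact ⟨φ, hφ, squeeze_zero (fun m => ha _) (fun m => (hlt m).le)
    tendsto_one_div_add_atTop_nhds_zero_nat⟩

theorem Stepsizes.not_summable_succ {α : ℕ → ℝ} (hα : Stepsizes α) :
    ¬ Summable fun k => α (k + 1) := by
  rw [not_summable_iff_tendsto_nat_atTop_of_nonneg fun k => hα.nonneg _]
  refine hα.sum_eq_top.congr fun m => ?_
  rw [Finset.range_eq_Ico, Finset.sum_Ico_add' (fun k => α k) 0 m 1]
  rfl

theorem summable_mul_of_summable_sq {u w : ℕ → ℝ} (hu : ∀ k, 0 ≤ u k) (hw : ∀ k, 0 ≤ w k)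
    (hus : Summable fun k => u k ^ 2) (hws : Summable fun k => w k ^ 2) :
    Summable fun k => u k * w k :=
  Summable.of_nonneg_of_le (fun k => mul_nonneg (hu k) (hw k))
    (fun k => by nlinarith [sq_nonneg (u k - w k), sq_nonneg (u k), sq_nonneg (w k)])
    (hus.add hws)

theorem tendsto_zero_of_summable_sq {u : ℕ → ℝ} (hs : Summable fun k => u k ^ 2) :
    Tendsto u atTop (𝓝 0) := by
  have := hs.tendsto_atTop_zero.sqrt
  simp only [Real.sqrt_sq_eq_abs, Real.sqrt_zero] at this
  exact (tendsto_zero_iff_abs_tendsto_zero u).2 this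

/-- If the averages `p` have square summable distances to the feasible set, the agents agree up to
a square summable error. -/
theorem summable_disagreement_sq_of_step {n N : ℕ} {X₀ X : Set (Vec n)} {f : Fin N → Vec n → ℝ}
    {G : ℕ → Digraph (Fin N)} {W : ℕ → Matrix (Fin N) (Fin N) ℝ} {α : ℕ → ℝ}
    (hW : DoublyStochasticWeights G W) (hG : QStronglyConnected G) (hα : Stepsizes α)
    (hXX₀ : X ⊆ X₀) (hcl : IsClosed X) (hne : X.Nonempty) {C : ℝ} (hC : 0 ≤ C)
    (hlip : ∀ i, ∀ u ∈ X₀, ∀ w ∈ X₀, f i u - f i w ≤ C * ‖u - w‖)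
    {x p : Fin N → ℕ → Vec n}
    (hp : ∀ i k, p i (k + 1) = ∑ j, W (k + 1) i j • x j k) (hpX₀ : ∀ i k, p i (k + 1) ∈ X₀)
    (hstep : ∀ i k, ∀ y ∈ X, ‖x i (k + 1) - y‖ ^ 2 ≤
      ‖p i (k + 1) - y‖ ^ 2 - 2 * α (k + 1) * (f i (p i (k + 1)) - f i y)
        + 2 * C ^ 2 * α (k + 1) ^ 2)
    (hdist : ∀ i, Summable fun k => Metric.infDist (p i (k + 1)) X ^ 2) :
    Summable fun k => disagreement x k ^ 2 := by
  have hα0 := hα.nonneg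
  -- The move away from the average is square summable.
  have hmove : ∀ i k, ‖x i (k + 1) - p i (k + 1)‖ ≤
      2 * Metric.infDist (p i (k + 1)) X + 2 * C * α (k + 1) := by
    intro i k
    obtain ⟨y, hyX, hy⟩ := hcl.exists_infDist_eq_dist hne (p i (k + 1))
    rw [dist_eq_norm] at hy
    have h1 := hstep i k y hyX
    have h2 := hlip i y (hXX₀ hyX) _ (hpX₀ i k)
    rw [norm_sub_rev, ← hy] at h2
    rw [← hy] at h1
    have hd0 : 0 ≤ Metric.infDist (p i (k + 1)) X := Metric.infDist_nonneg
    have hCα : 0 ≤ C * α (k + 1) := mul_nonneg hC (hα0 _)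
    have h3 : ‖x i (k + 1) - y‖ ≤ Metric.infDist (p i (k + 1)) X + 2 * C * α (k + 1) := by
      refine le_of_sq_le_sq ?_ (by linarith)
      nlinarith [mul_le_mul_of_nonneg_left h2 (hα0 (k + 1)), mul_nonneg hd0 hCα,
        sq_nonneg (C * α (k + 1))]
    calc ‖x i (k + 1) - p i (k + 1)‖ ≤ ‖x i (k + 1) - y‖ + ‖y - p i (k + 1)‖ :=
          norm_sub_le_norm_sub_add_norm_sub _ _ _
      _ ≤ _ := by rw [norm_sub_rev y, ← hy]; linarith
  have hmoveS : ∀ i, Summable fun k => ‖x i (k + 1) - p i (k + 1)‖ ^ 2 := by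
    intro i
    refine Summable.of_nonneg_of_le (fun _ => sq_nonneg _) (fun k => ?_)
      (((hdist i).mul_left 8).add (hα.sum_sq.mul_left (8 * C ^ 2)))
    have := pow_le_pow_left₀ (norm_nonneg _) (hmove i k) 2
    nlinarith [sq_nonneg (2 * Metric.infDist (p i (k + 1)) X - 2 * C * α (k + 1))]
  exact summable_disagreement_sq (e := fun i k => x i k - p i k) hW hG
    (fun i k => by rw [← hp]; abel) hmoveS

/-- A bounded sequence whose distances to `X` vanish and whose optimality gaps, corrected for
infeasibility, vanish along a subsequence has a cluster point that minimizes `F` over `X`. -/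
theorem exists_cluster_point_optimal {n : ℕ} {X₀ X : Set (Vec n)} (hXX₀ : X ⊆ X₀)
    (hcl : IsClosed X) (hne : X.Nonempty) {F : Vec n → ℝ} {K c : ℝ}
    (hF : ∀ u ∈ X₀, ∀ w ∈ X₀, F u - F w ≤ K * ‖u - w‖) {q : ℕ → Vec n} (hq : ∀ k, q k ∈ X₀)
    (hb : Bornology.IsBounded (Set.range q))
    (hd : Tendsto (fun k => Metric.infDist (q k) X) atTop (𝓝 0)) {φ : ℕ → ℕ} (hφ : StrictMono φ)
    (ha : Tendsto (fun m => F (q (φ m)) - c + K * Metric.infDist (q (φ m)) X) atTop (𝓝 0)) :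
    ∃ z ∈ X, F z ≤ c ∧ ∃ θ : ℕ → ℕ, Tendsto θ atTop atTop ∧
      Tendsto (fun m => ‖q (θ m) - z‖) atTop (𝓝 0) := by
  obtain ⟨z, -, ψ, hψ, hqz⟩ := tendsto_subseq_of_bounded hb fun m => Set.mem_range_self (φ m)
  have hsub : Tendsto (fun m => φ (ψ m)) atTop atTop := hφ.tendsto_atTop.comp hψ.tendsto_atTop
  have hzX : z ∈ X := by
    rw [hcl.mem_iff_infDist_zero hne]
    exact tendsto_nhds_unique ((Metric.continuous_infDist_pt X).continuousAt.tendsto.comp hqz)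
      (hd.comp hsub)
  have hqz0 : Tendsto (fun m => ‖q (φ (ψ m)) - z‖) atTop (𝓝 0) :=
    tendsto_iff_norm_sub_tendsto_zero.1 hqz
  refine ⟨z, hzX, ?_, fun m => φ (ψ m), hsub, hqz0⟩
  have hlim := (((ha.comp hψ.tendsto_atTop).add_const c).sub ((hd.comp hsub).const_mul K)).add
    (hqz0.const_mul K)
  simp only [Function.comp_def, mul_zero, sub_zero, add_zero, zero_add] at hlim
  refine ge_of_tendsto' hlim fun m => ?_
  have := hF z (hXX₀ hzX) _ (hq (φ (ψ m)))
  rw [norm_sub_rev] at this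
  linarith

/-- The deterministic part of the argument. The trajectory of a single sample point converges to
a common optimal point as soon as the averages `p` have square summable distances to the feasible
set: the agents then agree up to a square summable error, the squared distance to every optimal
point converges, and `∑ α k = ∞` produces an optimal cluster point. -/
theorem exists_tendsto_optimal {n N : ℕ} {ι : Type*} [NeZero N] {X₀ : Set (Vec n)}
    {J : Fin N → Finset ι} {g : ι → Vec n → ℝ} {f : Fin N → Vec n → ℝ}
    {G : ℕ → Digraph (Fin N)} {W : ℕ → Matrix (Fin N) (Fin N) ℝ} {α : ℕ → ℝ}
    (hopt : (optimal X₀ J g f).Nonempty) (hW : DoublyStochasticWeights G W)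
    (hG : QStronglyConnected G) (hα : Stepsizes α) (hX₀ : Convex ℝ X₀)
    (hcl : IsClosed (feasible X₀ J g)) {C : ℝ} (hC : 0 ≤ C)
    (hlip : ∀ i, ∀ u ∈ X₀, ∀ w ∈ X₀, f i u - f i w ≤ C * ‖u - w‖)
    {x p : Fin N → ℕ → Vec n} (hx : ∀ i k, x i k ∈ X₀)
    (hp : ∀ i k, p i (k + 1) = ∑ j, W (k + 1) i j • x j k)
    (hstep : ∀ i k, ∀ y ∈ feasible X₀ J g, ‖x i (k + 1) - y‖ ^ 2 ≤
      ‖p i (k + 1) - y‖ ^ 2 - 2 * α (k + 1) * (f i (p i (k + 1)) - f i y)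
        + 2 * C ^ 2 * α (k + 1) ^ 2)
    (hdist : ∀ i, Summable fun k => Metric.infDist (p i (k + 1)) (feasible X₀ J g) ^ 2) :
    ∃ z ∈ optimal X₀ J g f, ∀ i, Tendsto (fun k => x i k) atTop (𝓝 z) := by
  set X := feasible X₀ J g
  have hXX₀ : X ⊆ X₀ := fun y hy => hy.1
  obtain ⟨y₀, hy₀X, hy₀⟩ := hopt
  have hne : X.Nonempty := ⟨y₀, hy₀X⟩
  have hpX₀ : ∀ i k, p i (k + 1) ∈ X₀ := fun i k => by
    rw [hp]; exact average_mem hW hX₀ k i fun j => hx j k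
  have hα0 := hα.nonneg
  have hδS : Summable fun k => disagreement x k ^ 2 :=
    summable_disagreement_sq_of_step hW hG hα hXX₀ hcl hne hC hlip hp hpX₀ hstep hdist
  -- A fixed agent serves as the reference for all others.
  obtain ⟨q, hqdef⟩ : ∃ q : ℕ → Vec n, q = x 0 := ⟨_, rfl⟩
  have hqX₀ : ∀ k, q k ∈ X₀ := fun k => hqdef ▸ hx 0 k
  have hxq : ∀ i k, ‖x i k - q k‖ ≤ disagreement x k := fun i k =>
    hqdef ▸ norm_sub_le_disagreement x k i 0
  have hpq : ∀ i k, ‖p i (k + 1) - q k‖ ≤ disagreement x k := by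
    intro i k
    rw [hp, average_sub_average hW]
    calc ‖∑ j, W (k + 1) i j • (x j k - q k)‖ ≤ ∑ j, W (k + 1) i j * disagreement x k := by
          refine norm_sum_le_of_le _ fun j _ => ?_
          rw [norm_smul, Real.norm_of_nonneg (hW.nonneg _ (by omega) _ _)]
          exact mul_le_mul_of_nonneg_left (hxq j k) (hW.nonneg _ (by omega) _ _)
      _ = _ := by rw [← Finset.sum_mul, hW.row_sum _ (by omega), one_mul]
  have hqdist : Summable fun k => Metric.infDist (q k) X ^ 2 := by
    refine Summable.of_nonneg_of_le (fun _ => sq_nonneg _) (fun k => ?_)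
      (((hdist 0).mul_left 2).add (hδS.mul_left 2))
    have h1 : Metric.infDist (q k) X ≤ Metric.infDist (p 0 (k + 1)) X + disagreement x k :=
      Metric.infDist_le_infDist_add_dist.trans (by
        rw [dist_comm, dist_eq_norm]; linarith [hpq 0 k])
    have h2 := pow_le_pow_left₀ Metric.infDist_nonneg h1 2
    nlinarith [sq_nonneg (Metric.infDist (p 0 (k + 1)) X - disagreement x k)]
  let F : Vec n → ℝ := fun u => ∑ i, f i u
  have hFlip : ∀ u ∈ X₀, ∀ w ∈ X₀, F u - F w ≤ N * C * ‖u - w‖ := by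
    intro u hu w hw
    calc F u - F w = ∑ i, (f i u - f i w) := by simp [F, Finset.sum_sub_distrib]
      _ ≤ ∑ _i : Fin N, C * ‖u - w‖ := Finset.sum_le_sum fun i _ => hlip i u hu w hw
      _ = N * C * ‖u - w‖ := by simp [mul_assoc]
  have hNC : 0 ≤ N * C := by positivity
  -- The optimality gap of the reference, corrected for infeasibility so that it is nonnegative.
  let a : ℕ → ℝ := fun k => F (q k) - F y₀ + N * C * Metric.infDist (q k) X
  have ha0 : ∀ k, 0 ≤ a k := by
    intro k
    obtain ⟨y, hyX, hy⟩ := hcl.exists_infDist_eq_dist hne (q k)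
    have h1 := hFlip y (hXX₀ hyX) (q k) (hqX₀ k)
    have h2 : F y₀ ≤ F y := hy₀ y hyX
    rw [norm_sub_rev, ← dist_eq_norm, ← hy] at h1
    simp only [a]
    linarith
  let b : ℕ → ℝ := fun k => 2 * (N * C) * (α (k + 1) * Metric.infDist (q k) X)
    + 2 * (N * C) * (α (k + 1) * disagreement x k) + 2 * N * C ^ 2 * α (k + 1) ^ 2
  have hb0 : ∀ k, 0 ≤ b k := fun k => by
    have := hα0 (k + 1)
    have := disagreement_nonneg x k
    have : 0 ≤ Metric.infDist (q k) X := Metric.infDist_nonneg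
    positivity
  have hbS : Summable b :=
    (((summable_mul_of_summable_sq (fun k => hα0 (k + 1)) (fun _ => Metric.infDist_nonneg)
      hα.sum_sq hqdist).mul_left _).add ((summable_mul_of_summable_sq (fun k => hα0 (k + 1))
      (disagreement_nonneg x) hα.sum_sq hδS).mul_left _)).add (hα.sum_sq.mul_left _)
  have hV : ∀ y ∈ X, F y = F y₀ → ∀ k, ∑ i, ‖x i (k + 1) - y‖ ^ 2 ≤
      ∑ i, ‖x i k - y‖ ^ 2 - 2 * (α (k + 1) * a k) + b k := by
    intro y hyX hFy k
    have h1 : ∀ i, ‖x i (k + 1) - y‖ ^ 2 ≤ ‖p i (k + 1) - y‖ ^ 2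
        - 2 * α (k + 1) * (f i (q k) - f i y) + 2 * α (k + 1) * (C * disagreement x k)
        + 2 * C ^ 2 * α (k + 1) ^ 2 := by
      intro i
      have h2 := hlip i (q k) (hqX₀ k) _ (hpX₀ i k)
      rw [norm_sub_rev] at h2
      have h3 := mul_le_mul_of_nonneg_left (hpq i k) hC
      have h4 := mul_le_mul_of_nonneg_left (h2.trans h3) (hα0 (k + 1))
      linarith [hstep i k y hyX]
    have h2 : ∑ i, ‖p i (k + 1) - y‖ ^ 2 ≤ ∑ i, ‖x i k - y‖ ^ 2 := by
      simp only [hp, average_sub_average hW]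
      exact sum_norm_sq_average_le hW k fun j => x j k - y
    have h3 := Finset.sum_le_sum fun i (_ : i ∈ Finset.univ) => h1 i
    simp only [Finset.sum_add_distrib, Finset.sum_sub_distrib, ← Finset.mul_sum,
      Finset.sum_const, Finset.card_univ, Fintype.card_fin, nsmul_eq_mul] at h3
    simp only [a, b, ← hFy, F]
    linarith
  have hconv : ∀ y ∈ X, F y = F y₀ → (∃ l, Tendsto (fun k => ∑ i, ‖x i k - y‖ ^ 2) atTop (𝓝 l)) ∧
      Summable fun k => 2 * (α (k + 1) * a k) := fun y hyX hFy =>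
    tendsto_and_summable_of_le_sub_add (fun k => Finset.sum_nonneg fun _ _ => sq_nonneg _) hb0
      (fun k => mul_nonneg zero_le_two (mul_nonneg (hα0 _) (ha0 k))) hbS (hV y hyX hFy)
  obtain ⟨⟨l₀, hl₀⟩, hαa⟩ := hconv y₀ hy₀X rfl
  obtain ⟨φ, hφ, haφ⟩ := exists_subseq_tendsto_zero (fun k => hα0 (k + 1)) ha0
    hα.not_summable_succ ((hαa.mul_left (1 / 2)).congr fun k => by ring)
  obtain ⟨B, hB⟩ := hl₀.bddAbove_range
  have hqB : Set.range q ⊆ Metric.closedBall y₀ (Real.sqrt B) := by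
    rintro _ ⟨k, rfl⟩
    rw [mem_closedBall_iff_norm, hqdef]
    exact Real.le_sqrt_of_sq_le ((Finset.single_le_sum (f := fun i => ‖x i k - y₀‖ ^ 2)
      (fun _ _ => sq_nonneg _) (Finset.mem_univ 0)).trans (hB ⟨k, rfl⟩))
  obtain ⟨z, hzX, hFz', θ, hθ, hqz⟩ := exists_cluster_point_optimal hXX₀ hcl hne hFlip hqX₀
    (Metric.isBounded_closedBall.subset hqB) (tendsto_zero_of_summable_sq hqdist) hφ haφ
  have hFz : F z = F y₀ := le_antisymm hFz' (hy₀ z hzX)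
  obtain ⟨⟨l, hl⟩, -⟩ := hconv z hzX hFz
  have hl0 : l = 0 := by
    refine tendsto_nhds_unique (hl.comp hθ) ?_
    have h1 : ∀ i, Tendsto (fun m => ‖x i (θ m) - z‖) atTop (𝓝 0) := fun i => by
      refine squeeze_zero (fun _ => norm_nonneg _) (fun m =>
        (norm_sub_le_norm_sub_add_norm_sub _ (q (θ m)) _).trans
          (add_le_add_left (hxq i _) _)) ?_
      simpa using ((tendsto_zero_of_summable_sq hδS).comp hθ).add hqz
    simpa [Function.comp_def] using tendsto_finsetSum Finset.univ fun i _ => (h1 i).pow 2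
  refine ⟨z, ⟨hzX, fun y hy => hFz.le.trans (hy₀ y hy)⟩, fun i => ?_⟩
  rw [tendsto_iff_norm_sub_tendsto_zero]
  rw [hl0] at hl
  have := (squeeze_zero (fun _ => sq_nonneg _) (fun k => Finset.single_le_sum
    (f := fun i => ‖x i k - z‖ ^ 2) (fun _ _ => sq_nonneg _) (Finset.mem_univ i)) hl).sqrt
  simpa using this

/-! ### Summability in expectation -/

open scoped ENNReal in
/-- The expectation form of the descent. The bound `E k ≤ I k` keeps all terms finite, so that
`E k / 2` can be cancelled. -/
theorem tsum_ne_top_of_add_le_add {I E b : ℕ → ℝ≥0∞} (hI : I 0 ≠ ∞) (hb : ∑' k, b k ≠ ∞)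
    (hE : ∀ k, E k ≤ I k) (h : ∀ k, I (k + 1) + E k ≤ I k + E k / 2 + b k) :
    ∑' k, E k ≠ ∞ := by
  have hbk : ∀ k, b k ≠ ∞ := fun k => ne_top_of_le_ne_top hb (ENNReal.le_tsum k)
  have hIk : ∀ k, I k ≠ ∞ := by
    intro k
    induction k with
    | zero => exact hI
    | succ k ih =>
      refine ne_top_of_le_ne_top ?_ (le_self_add.trans (h k))
      have := ENNReal.div_ne_top (ne_top_of_le_ne_top ih (hE k)) (two_ne_zero)
      exact ENNReal.add_ne_top.2 ⟨ENNReal.add_ne_top.2 ⟨ih, this⟩, hbk k⟩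
  have hstep : ∀ k, I (k + 1) + E k / 2 ≤ I k + b k := by
    intro k
    have hfin := ENNReal.div_ne_top (ne_top_of_le_ne_top (hIk k) (hE k)) (two_ne_zero)
    refine (ENNReal.add_le_add_iff_right hfin).1 ?_
    rw [add_assoc, ENNReal.add_halves, add_right_comm]
    exact h k
  have hsum : ∀ m, I m + ∑ k ∈ Finset.range m, E k / 2 ≤ I 0 + ∑ k ∈ Finset.range m, b k := by
    intro m
    induction m with
    | zero => simp
    | succ m ih =>
      rw [Finset.sum_range_succ, Finset.sum_range_succ]
      calc I (m + 1) + (∑ k ∈ Finset.range m, E k / 2 + E m / 2)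
          = (I (m + 1) + E m / 2) + ∑ k ∈ Finset.range m, E k / 2 := by ring
        _ ≤ (I m + b m) + ∑ k ∈ Finset.range m, E k / 2 := add_le_add_left (hstep m) _
        _ = (I m + ∑ k ∈ Finset.range m, E k / 2) + b m := by ring
        _ ≤ (I 0 + ∑ k ∈ Finset.range m, b k) + b m := by gcongr
        _ = _ := by ring
  have hhalf : ∑' k, E k / 2 ≤ I 0 + ∑' k, b k := by
    rw [ENNReal.tsum_eq_iSup_nat]
    exact iSup_le fun m => le_add_self.trans ((hsum m).trans (by
      gcongr; exact ENNReal.sum_le_tsum _))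
  have h2 : ∑' k, E k / 2 ≠ ∞ := ne_top_of_le_ne_top (ENNReal.add_ne_top.2 ⟨hI, hb⟩) hhalf
  have h3 : ∑' k, E k = (∑' k, E k / 2) * 2 := by
    rw [← ENNReal.tsum_mul_right]
    exact tsum_congr fun k => (ENNReal.div_mul_cancel two_ne_zero ENNReal.ofNat_ne_top).symm
  rw [h3]
  exact ENNReal.mul_ne_top h2 ENNReal.ofNat_ne_top

open scoped ENNReal in
/-- A stochastic descent inequality `D (k + 1) + T k ≤ D k + E k / 2 + b k`, in which the sampled
gain `T k` has the conditional expectation `E k`, forces `∑ E k < ∞` almost surely. Since `D 0`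
need not be integrable, all expectations carry the weight `(1 + D 0)⁻¹`. -/
theorem ae_tsum_ne_top_of_descent {Ω : Type*} [mΩ : MeasurableSpace Ω] {P : Measure Ω}
    [IsProbabilityMeasure P] {D E T : ℕ → Ω → ℝ≥0∞} {b : ℕ → ℝ≥0∞}
    (hDm : ∀ k, Measurable (D k)) (hEm : ∀ k, Measurable (E k)) (hD : ∀ ω, D 0 ω ≠ ∞)
    (hb : ∑' k, b k ≠ ∞) (hED : ∀ k ω, E k ω ≤ D k ω)
    (h : ∀ k ω, D (k + 1) ω + T k ω ≤ D k ω + E k ω / 2 + b k)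
    (hT : ∀ k, ∫⁻ ω, (1 + D 0 ω)⁻¹ * T k ω ∂P = ∫⁻ ω, (1 + D 0 ω)⁻¹ * E k ω ∂P) :
    ∀ᵐ ω ∂P, ∑' k, E k ω ≠ ∞ := by
  let w : Ω → ℝ≥0∞ := fun ω => (1 + D 0 ω)⁻¹
  have hw : Measurable w := (measurable_const.add (hDm 0)).inv
  have hw1 : ∀ ω, w ω ≤ 1 := fun ω => ENNReal.inv_le_one.2 le_self_add
  have hw0 : ∀ ω, w ω ≠ 0 := fun ω =>
    ENNReal.inv_ne_zero.2 (ENNReal.add_ne_top.2 ⟨ENNReal.one_ne_top, hD ω⟩)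
  have hwD : ∀ ω, w ω * D 0 ω ≤ 1 := fun ω =>
    (mul_le_mul_right le_add_self _).trans (ENNReal.inv_mul_le_one _)
  have hsum : ∑' k, ∫⁻ ω, w ω * E k ω ∂P ≠ ∞ := by
    refine tsum_ne_top_of_add_le_add (I := fun k => ∫⁻ ω, w ω * D k ω ∂P) ?_ hb
      (fun k => lintegral_mono fun ω => mul_le_mul_right (hED k ω) _) fun k => ?_
    · refine ne_top_of_le_ne_top ENNReal.one_ne_top ((lintegral_mono hwD).trans ?_)
      simp
    · calc ∫⁻ ω, w ω * D (k + 1) ω ∂P + ∫⁻ ω, w ω * E k ω ∂P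
          = ∫⁻ ω, w ω * (D (k + 1) ω + T k ω) ∂P := by
            rw [← show ∫⁻ ω, w ω * T k ω ∂P = ∫⁻ ω, w ω * E k ω ∂P from hT k,
              ← lintegral_add_left (hw.fun_mul (hDm _))]
            simp only [mul_add]
        _ ≤ ∫⁻ ω, (w ω * D k ω + w ω * E k ω / 2 + b k) ∂P := by
            refine lintegral_mono fun ω => ?_
            calc w ω * (D (k + 1) ω + T k ω) ≤ w ω * (D k ω + E k ω / 2 + b k) :=
                  mul_le_mul_right (h k ω) _
              _ = w ω * D k ω + w ω * E k ω / 2 + w ω * b k := by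
                  rw [mul_add, mul_add, mul_div_assoc]
              _ ≤ _ := by
                  gcongr
                  exact mul_le_of_le_one_left' (hw1 ω)
        _ = _ := by
            rw [lintegral_add_right _ measurable_const, lintegral_add_left (hw.fun_mul (hDm _))]
            simp only [div_eq_mul_inv]
            rw [lintegral_mul_const _ (hw.fun_mul (hEm k))]
            simp
  rw [← lintegral_tsum fun k => (hw.fun_mul (hEm k)).aemeasurable] at hsum
  filter_upwards [ae_lt_top (Measurable.tsum fun k => hw.fun_mul (hEm k)) hsum] with ω hω
  rw [ENNReal.tsum_mul_left] at hω
  exact fun htop => hω.ne (by rw [htop, ENNReal.mul_top (hw0 ω)])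

open scoped ENNReal in
/-- A fresh sample is averaged out: its law replaces it in the expectation of a quantity that
otherwise depends on the past only. -/
theorem Sampling.lintegral_comp_idx {N : ℕ} {ι Ω : Type*} [MeasurableSpace ι]
    [MeasurableSingletonClass ι] [mΩ : MeasurableSpace Ω] {P : Measure Ω} {ℱ : Filtration ℕ mΩ}
    {J : Fin N → Finset ι} {π : Fin N → PMF ι} {idx : Fin N → ℕ → Ω → ι}
    (hs : Sampling P ℱ J π idx) (i : Fin N) (k : ℕ) {w : Ω → ℝ≥0∞} {h : ι → Ω → ℝ≥0∞}
    (hw : Measurable[ℱ k] w) (hh : ∀ j ∈ J i, Measurable[ℱ k] (h j)) :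
    Measurable (fun ω => h (idx i (k + 1) ω) ω) ∧
    ∫⁻ ω, w ω * h (idx i (k + 1) ω) ω ∂P = ∫⁻ ω, w ω * ∑ j ∈ J i, π i j * h j ω ∂P := by
  classical
  have hidx : Measurable (idx i (k + 1)) := (hs.adapted i (k + 1) (by omega)).mono (ℱ.le _) le_rfl
  let χ : ι → Ω → ℝ≥0∞ := fun j => (idx i (k + 1) ⁻¹' {j}).indicator 1
  have hpre : ∀ j, MeasurableSet (idx i (k + 1) ⁻¹' {j}) := fun j =>
    hidx (measurableSet_singleton j)
  have hχ : ∀ j, Measurable (χ j) := fun j => measurable_one.indicator (hpre j)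
  have hdecomp : ∀ ω, h (idx i (k + 1) ω) ω = ∑ j ∈ J i, h j ω * χ j ω := by
    intro ω
    rw [Finset.sum_eq_single (idx i (k + 1) ω)]
    · simp [χ]
    · intro j _ hj
      simp [χ, hj.symm]
    · exact fun hn => absurd (hs.mem i (k + 1) (by omega) ω) hn
  have hhm : ∀ j ∈ J i, Measurable (h j) := fun j hj => (hh j hj).mono (ℱ.le k) le_rfl
  have hwm : Measurable w := hw.mono (ℱ.le k) le_rfl
  constructor
  · simp only [hdecomp]
    exact Finset.measurable_sum _ fun j hj => (hhm j hj).fun_mul (hχ j)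
  simp only [hdecomp, Finset.mul_sum]
  rw [lintegral_finsetSum _ fun j hj => hwm.fun_mul ((hhm j hj).fun_mul (hχ j)),
    lintegral_finsetSum _ fun j hj => hwm.fun_mul ((hhm j hj).const_mul _)]
  refine Finset.sum_congr rfl fun j hj => ?_
  have hcomap : MeasurableSpace.comap (idx i (k + 1)) inferInstance ≤
      ⨆ i, MeasurableSpace.comap (idx i (k + 1)) inferInstance :=
    le_iSup (fun i => MeasurableSpace.comap (idx i (k + 1)) inferInstance) i
  have hind : Indep (ℱ k) (MeasurableSpace.comap (idx i (k + 1)) inferInstance) P :=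
    (indep_of_indep_of_le_left (hs.fresh k) hcomap).symm
  have hχc : Measurable[MeasurableSpace.comap (idx i (k + 1)) inferInstance] (χ j) :=
    (measurable_one.indicator (measurableSet_singleton j)).comp (comap_measurable (idx i (k + 1)))
  calc ∫⁻ ω, w ω * (h j ω * χ j ω) ∂P = ∫⁻ ω, (w ω * h j ω) * χ j ω ∂P := by
        simp only [mul_assoc]
    _ = (∫⁻ ω, w ω * h j ω ∂P) * ∫⁻ ω, χ j ω ∂P :=
        lintegral_mul_eq_lintegral_mul_lintegral_of_independent_measurableSpace (ℱ.le k)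
          hidx.comap_le hind (hw.fun_mul (hh j hj)) hχc
    _ = π i j * ∫⁻ ω, w ω * h j ω ∂P := by
        rw [lintegral_indicator_one (hpre j), hs.law i (k + 1) (by omega) j hj, mul_comm]
    _ = ∫⁻ ω, w ω * (π i j * h j ω) ∂P := by
        rw [← lintegral_const_mul _ (hwm.fun_mul (hhm j hj))]
        simp only [mul_left_comm]

/-! ### Distances of the averages to the feasible set -/

/-- The expectation of the squared violation `g⁺(u, ·)²` under the sampling distribution of
agent `i`. -/
noncomputable def meanViolation {n N : ℕ} {ι : Type*} (J : Fin N → Finset ι)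
    (g : ι → Vec n → ℝ) (π : Fin N → PMF ι) (i : Fin N) (u : Vec n) : ℝ :=
  ∑ j ∈ J i, (π i j).toReal * gplus g j u ^ 2

theorem meanViolation_nonneg {n N : ℕ} {ι : Type*} (J : Fin N → Finset ι)
    (g : ι → Vec n → ℝ) (π : Fin N → PMF ι) (i : Fin N) (u : Vec n) :
    0 ≤ meanViolation J g π i u :=
  Finset.sum_nonneg fun _ _ => mul_nonneg ENNReal.toReal_nonneg (sq_nonneg _)

/-- The mean violation is at most a multiple of the squared distance to the feasible set. -/
theorem meanViolation_le {n N : ℕ} {ι : Type*} {J : Fin N → Finset ι}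
    {g : ι → Vec n → ℝ} {π : Fin N → PMF ι} {X₀ : Set (Vec n)}
    (hcl : IsClosed (feasible X₀ J g)) (hne : (feasible X₀ J g).Nonempty) {K : ℝ}
    (hglip : ∀ i, ∀ j ∈ J i, ∀ u ∈ X₀, ∀ w ∈ X₀, gplus g j u - gplus g j w ≤ K * ‖u - w‖)
    (i : Fin N) {u : Vec n} (hu : u ∈ X₀) :
    meanViolation J g π i u ≤ K ^ 2 * Metric.infDist u (feasible X₀ J g) ^ 2 := by
  obtain ⟨y, hyX, hy⟩ := hcl.exists_infDist_eq_dist hne u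
  have hg : ∀ j ∈ J i, gplus g j u ^ 2 ≤ K ^ 2 * Metric.infDist u (feasible X₀ J g) ^ 2 := by
    intro j hj
    have h1 := hglip i j hj u hu y hyX.1
    rw [← dist_eq_norm, ← hy, show gplus g j y = 0 from max_eq_right (hyX.2 i j hj),
      sub_zero] at h1
    rw [← mul_pow]
    exact pow_le_pow_left₀ (gplus_nonneg g j u) h1 2
  have hπ : ∑ j ∈ J i, (π i j).toReal ≤ 1 := by
    rw [← ENNReal.toReal_sum fun j _ => (π i).apply_ne_top j]
    refine ENNReal.toReal_le_of_le_ofReal zero_le_one ?_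
    rw [ENNReal.ofReal_one, ← (π i).tsum_coe]
    exact ENNReal.sum_le_tsum _
  calc meanViolation J g π i u
      ≤ ∑ j ∈ J i, (π i j).toReal * (K ^ 2 * Metric.infDist u (feasible X₀ J g) ^ 2) :=
        Finset.sum_le_sum fun j hj => mul_le_mul_of_nonneg_left (hg j hj) ENNReal.toReal_nonneg
    _ ≤ _ := by
        rw [← Finset.sum_mul]
        exact mul_le_of_le_one_left (by positivity) hπ

/-- Descent of the squared distances to the feasible set in one round. The term linear in the
distance is absorbed by the error bound, at the cost of half of the mean violation. -/
theorem sum_infDist_sq_step_le {n N : ℕ} {X₀ X : Set (Vec n)} {f : Fin N → Vec n → ℝ}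
    {G : ℕ → Digraph (Fin N)} {W : ℕ → Matrix (Fin N) (Fin N) ℝ}
    (hW : DoublyStochasticWeights G W) (hXX₀ : X ⊆ X₀) (hX : Convex ℝ X)
    (hcl : IsClosed X) (hne : X.Nonempty) {C a c β : ℝ} (ha : 0 < a) (hc : 0 < c) (hβ : 0 ≤ β)
    (hlip : ∀ i, ∀ u ∈ X₀, ∀ w ∈ X₀, f i u - f i w ≤ C * ‖u - w‖) {k : ℕ}
    {x x' p : Fin N → Vec n} {t m : Fin N → ℝ}
    (hp : ∀ i, p i = ∑ j, W (k + 1) i j • x j) (hpX₀ : ∀ i, p i ∈ X₀)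
    (hstep : ∀ i, ∀ y ∈ X, ‖x' i - y‖ ^ 2 ≤
      ‖p i - y‖ ^ 2 - 2 * β * (f i (p i) - f i y) + 2 * C ^ 2 * β ^ 2 - a * t i)
    (hm : ∀ i, Metric.infDist (p i) X ^ 2 ≤ c * m i) :
    ∑ i, Metric.infDist (x' i) X ^ 2 + ∑ i, a * t i ≤
      ∑ i, Metric.infDist (x i) X ^ 2 + (∑ i, a * m i) / 2
        + N * (2 * C ^ 2 + 2 * c * C ^ 2 / a) * β ^ 2 := by
  have h1 : ∀ i, Metric.infDist (x' i) X ^ 2 + a * t i ≤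
      Metric.infDist (p i) X ^ 2 + a * m i / 2 + (2 * C ^ 2 + 2 * c * C ^ 2 / a) * β ^ 2 := by
    intro i
    obtain ⟨y, hyX, hy⟩ := hcl.exists_infDist_eq_dist hne (p i)
    rw [dist_eq_norm] at hy
    have h2 := hstep i y hyX
    have h3 := hlip i y (hXX₀ hyX) (p i) (hpX₀ i)
    rw [norm_sub_rev, ← hy] at h3
    rw [← hy] at h2
    have h4 : Metric.infDist (x' i) X ^ 2 ≤ ‖x' i - y‖ ^ 2 :=
      pow_le_pow_left₀ Metric.infDist_nonneg
        (by rw [← dist_eq_norm]; exact Metric.infDist_le_dist_of_mem hyX) 2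
    have h5 := mul_le_mul_of_nonneg_left h3 hβ
    -- Young's inequality with parameter `a / (2 c)`.
    have h6 : 2 * β * C * Metric.infDist (p i) X ≤
        a / (2 * c) * Metric.infDist (p i) X ^ 2 + 2 * c * C ^ 2 / a * β ^ 2 := by
      have h7 : a / (2 * c) * Metric.infDist (p i) X ^ 2 + 2 * c * C ^ 2 / a * β ^ 2
          - 2 * β * C * Metric.infDist (p i) X =
          a / (2 * c) * (Metric.infDist (p i) X - 2 * c / a * (C * β)) ^ 2 := by
        field_simp
        ring
      have : 0 ≤ a / (2 * c) * (Metric.infDist (p i) X - 2 * c / a * (C * β)) ^ 2 := by positivity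
      linarith
    have h8 : a / (2 * c) * Metric.infDist (p i) X ^ 2 ≤ a * m i / 2 := by
      calc a / (2 * c) * Metric.infDist (p i) X ^ 2 ≤ a / (2 * c) * (c * m i) := by
            gcongr; exact hm i
        _ = a * m i / 2 := by field_simp
    linarith
  have h2 : ∑ i, Metric.infDist (p i) X ^ 2 ≤ ∑ i, Metric.infDist (x i) X ^ 2 := by
    simp only [hp]
    exact sum_infDist_sq_average_le hW hX hcl hne k x
  have h3 := Finset.sum_le_sum fun i (_ : i ∈ Finset.univ) => h1 i
  simp only [Finset.sum_add_distrib, ← Finset.sum_div, Finset.sum_const, Finset.card_univ,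
    Fintype.card_fin, nsmul_eq_mul] at h3
  linarith

theorem ofReal_mul_meanViolation {n N : ℕ} {ι : Type*} (J : Fin N → Finset ι)
    (g : ι → Vec n → ℝ) (π : Fin N → PMF ι) (i : Fin N) (u : Vec n) {a : ℝ} (ha : 0 ≤ a) :
    ENNReal.ofReal (a * meanViolation J g π i u) =
      ∑ j ∈ J i, π i j * ENNReal.ofReal (a * gplus g j u ^ 2) := by
  rw [meanViolation, Finset.mul_sum, ENNReal.ofReal_sum_of_nonneg fun j _ =>
    mul_nonneg ha (mul_nonneg ENNReal.toReal_nonneg (sq_nonneg _))]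
  refine Finset.sum_congr rfl fun j _ => ?_
  rw [mul_left_comm, ENNReal.ofReal_mul ENNReal.toReal_nonneg,
    ENNReal.ofReal_toReal ((π i).apply_ne_top j)]

theorem _root_.ContinuousOn.measurable_comp_of_mem {Ω A B : Type*} [m : MeasurableSpace Ω]
    [TopologicalSpace A] [MeasurableSpace A] [BorelSpace A] [TopologicalSpace B]
    [MeasurableSpace B] [BorelSpace B] {h : A → B} {S : Set A} (hh : ContinuousOn h S)
    {u : Ω → A} (hu : Measurable u) (hS : ∀ ω, u ω ∈ S) : Measurable fun ω => h (u ω) :=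
  (continuousOn_iff_continuous_domRestrict.1 hh).measurable.comp (hu.subtype_mk (h := hS))

/-- Almost surely the averages have square summable distances to the feasible set. -/
theorem ae_summable_infDist_sq {n N : ℕ} {ι Ω : Type*} [MeasurableSpace ι]
    [MeasurableSingletonClass ι] [mΩ : MeasurableSpace Ω] {P : Measure Ω} [IsProbabilityMeasure P]
    {ℱ : Filtration ℕ mΩ} {X₀ : Set (Vec n)} {J : Fin N → Finset ι} {g : ι → Vec n → ℝ}
    {f : Fin N → Vec n → ℝ} {π : Fin N → PMF ι} {G : ℕ → Digraph (Fin N)}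
    {W : ℕ → Matrix (Fin N) (Fin N) ℝ} {α : ℕ → ℝ} {idx : Fin N → ℕ → Ω → ι}
    {x p : Fin N → ℕ → Ω → Vec n}
    (hW : DoublyStochasticWeights G W) (hα : Stepsizes α) (hs : Sampling P ℱ J π idx)
    (hX : Convex ℝ (feasible X₀ J g)) (hcl : IsClosed (feasible X₀ J g))
    (hne : (feasible X₀ J g).Nonempty) {C K c : ℝ} (hK : 0 < K) (hc : 0 < c)
    (herr : ∀ i, ∀ u ∈ X₀, Metric.infDist u (feasible X₀ J g) ^ 2 ≤ c * meanViolation J g π i u)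
    (hlip : ∀ i, ∀ u ∈ X₀, ∀ w ∈ X₀, f i u - f i w ≤ C * ‖u - w‖)
    (hglip : ∀ i, ∀ j ∈ J i, ∀ u ∈ X₀, ∀ w ∈ X₀, gplus g j u - gplus g j w ≤ K * ‖u - w‖)
    (hgcont : ∀ i, ∀ j ∈ J i, ContinuousOn (gplus g j) X₀)
    (hadapt : ∀ i k, Measurable[ℱ k] (x i k))
    (hp : ∀ i k ω, p i (k + 1) ω = ∑ j, W (k + 1) i j • x j k ω)
    (hpX₀ : ∀ i k ω, p i (k + 1) ω ∈ X₀)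
    (hstep : ∀ i k ω, ∀ y ∈ feasible X₀ J g, ‖x i (k + 1) ω - y‖ ^ 2 ≤
      ‖p i (k + 1) ω - y‖ ^ 2 - 2 * α (k + 1) * (f i (p i (k + 1) ω) - f i y)
        + 2 * C ^ 2 * α (k + 1) ^ 2
        - 1 / (2 * K ^ 2) * gplus g (idx i (k + 1) ω) (p i (k + 1) ω) ^ 2) :
    ∀ᵐ ω ∂P, ∀ i,
      Summable fun k => Metric.infDist (p i (k + 1) ω) (feasible X₀ J g) ^ 2 := by
  set X := feasible X₀ J g
  obtain ⟨a, haK⟩ : ∃ a : ℝ, a = 1 / (2 * K ^ 2) := ⟨_, rfl⟩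
  have ha : 0 < a := by rw [haK]; positivity
  simp only [← haK] at hstep
  let M : ℝ := N * (2 * C ^ 2 + 2 * c * C ^ 2 / a)
  have hM : 0 ≤ M := by positivity
  let D : ℕ → Ω → ENNReal := fun k ω => ENNReal.ofReal (∑ i, Metric.infDist (x i k ω) X ^ 2)
  let E : ℕ → Ω → ENNReal := fun k ω =>
    ENNReal.ofReal (∑ i, a * meanViolation J g π i (p i (k + 1) ω))
  let h : Fin N → ℕ → ι → Ω → ENNReal := fun i k j ω =>
    ENNReal.ofReal (a * gplus g j (p i (k + 1) ω) ^ 2)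
  let T : ℕ → Ω → ENNReal := fun k ω => ∑ i, h i k (idx i (k + 1) ω) ω
  have hmv : ∀ i u, 0 ≤ a * meanViolation J g π i u := fun i u =>
    mul_nonneg ha.le (meanViolation_nonneg J g π i u)
  have hEsum : ∀ k ω, E k ω = ∑ i, ∑ j ∈ J i, π i j * h i k j ω := by
    intro k ω
    simp only [E, h]
    rw [ENNReal.ofReal_sum_of_nonneg fun i _ => hmv i _]
    exact Finset.sum_congr rfl fun i _ => ofReal_mul_meanViolation J g π i _ ha.le
  have hDF : ∀ k, Measurable[ℱ k] (D k) := fun k =>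
    ENNReal.measurable_ofReal.comp (Finset.measurable_sum _ fun i _ =>
      ((Metric.continuous_infDist_pt X).measurable.comp (hadapt i k)).pow_const 2)
  have hpF : ∀ i k, Measurable[ℱ k] (p i (k + 1)) := by
    intro i k
    rw [show p i (k + 1) = fun ω => ∑ j, W (k + 1) i j • x j k ω from funext (hp i k)]
    exact Finset.measurable_sum _ fun j _ => (hadapt j k).fun_const_smul _
  have hhF : ∀ i k, ∀ j ∈ J i, Measurable[ℱ k] (h i k j) := fun i k j hj =>
    ENNReal.measurable_ofReal.comp (((ContinuousOn.measurable_comp_of_mem (m := ℱ k)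
      (hgcont i j hj) (hpF i k) (hpX₀ i k)).pow_const 2).const_mul a)
  have hDm : ∀ k, Measurable (D k) := fun k => (hDF k).mono (ℱ.le k) le_rfl
  have hhm : ∀ i k, ∀ j ∈ J i, Measurable (h i k j) := fun i k j hj =>
    (hhF i k j hj).mono (ℱ.le k) le_rfl
  have hEm : ∀ k, Measurable (E k) := by
    intro k
    rw [funext (hEsum k)]
    exact Finset.measurable_sum _ fun i _ => Finset.measurable_sum _ fun j hj =>
      (hhm i k j hj).const_mul _
  have hwF : ∀ k, Measurable[ℱ k] fun ω => (1 + D 0 ω)⁻¹ := fun k =>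
    Measurable.inv (Measurable.const_add ((hDF 0).mono (ℱ.mono (Nat.zero_le k)) le_rfl) 1)
  have hmain : ∀ᵐ ω ∂P, ∑' k, E k ω ≠ ⊤ := by
    refine ae_tsum_ne_top_of_descent (D := D) (T := T)
      (b := fun k => ENNReal.ofReal (M * α (k + 1) ^ 2)) hDm hEm (fun ω => ENNReal.ofReal_ne_top)
      ?_ (fun k ω => ?_) (fun k ω => ?_) fun k => ?_
    · exact (hα.sum_sq.mul_left M).tsum_ofReal_ne_top
    · refine ENNReal.ofReal_le_ofReal ?_
      calc ∑ i, a * meanViolation J g π i (p i (k + 1) ω)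
          ≤ ∑ i, Metric.infDist (p i (k + 1) ω) X ^ 2 := Finset.sum_le_sum fun i _ => by
            have h1 := mul_le_mul_of_nonneg_left
              (meanViolation_le (π := π) hcl hne hglip i (hpX₀ i k ω)) ha.le
            have h2 : a * K ^ 2 = 1 / 2 := by rw [haK]; field_simp
            rw [← mul_assoc, h2] at h1
            linarith [sq_nonneg (Metric.infDist (p i (k + 1) ω) X)]
        _ ≤ _ := by
            simp only [hp]
            exact sum_infDist_sq_average_le hW hX hcl hne k _
    · have h1 := sum_infDist_sq_step_le (x := fun i => x i k ω) (x' := fun i => x i (k + 1) ω)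
        hW (fun y hy => hy.1) hX hcl hne ha hc (hα.nonneg (k + 1)) hlip (fun i => hp i k ω)
        (fun i => hpX₀ i k ω) (fun i => hstep i k ω) (fun i => herr i _ (hpX₀ i k ω))
      have hT : T k ω = ENNReal.ofReal
          (∑ i, a * gplus g (idx i (k + 1) ω) (p i (k + 1) ω) ^ 2) := by
        rw [ENNReal.ofReal_sum_of_nonneg fun i _ => mul_nonneg ha.le (sq_nonneg _)]
      have hS0 : ∀ k, 0 ≤ ∑ i, Metric.infDist (x i k ω) X ^ 2 := fun k =>
        Finset.sum_nonneg fun _ _ => sq_nonneg _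
      have hm0 : 0 ≤ ∑ i, a * meanViolation J g π i (p i (k + 1) ω) :=
        Finset.sum_nonneg fun i _ => hmv i _
      have hE2 : E k ω / 2 =
          ENNReal.ofReal ((∑ i, a * meanViolation J g π i (p i (k + 1) ω)) / 2) := by
        rw [ENNReal.ofReal_div_of_pos two_pos, ENNReal.ofReal_ofNat]
      rw [hT, hE2, ← ENNReal.ofReal_add (hS0 _)
        (Finset.sum_nonneg fun i _ => mul_nonneg ha.le (sq_nonneg _)),
        ← ENNReal.ofReal_add (hS0 _) (by positivity), ← ENNReal.ofReal_add
        (add_nonneg (hS0 _) (by positivity)) (mul_nonneg hM (sq_nonneg _))]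
      exact ENNReal.ofReal_le_ofReal h1
    · have hw : Measurable fun ω => (1 + D 0 ω)⁻¹ := (hwF 0).mono (ℱ.le 0) le_rfl
      have hsamp := fun i => hs.lintegral_comp_idx i k (hwF k) (hhF i k)
      simp only [T, hEsum, Finset.mul_sum]
      rw [lintegral_finsetSum _ fun i _ => hw.fun_mul (hsamp i).1, lintegral_finsetSum]
      · exact Finset.sum_congr rfl fun i _ => by rw [(hsamp i).2]; simp only [Finset.mul_sum]
      · exact fun i _ => Finset.measurable_sum _ fun j hj =>
          hw.fun_mul ((hhm i k j hj).const_mul _)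
  filter_upwards [hmain] with ω hω i
  have hsum : Summable fun k => ∑ i, a * meanViolation J g π i (p i (k + 1) ω) := by
    refine (ENNReal.summable_toReal hω).congr fun k => ?_
    exact ENNReal.toReal_ofReal (Finset.sum_nonneg fun i _ => hmv i _)
  refine Summable.of_nonneg_of_le (fun _ => sq_nonneg _) (fun k => ?_) (hsum.mul_left (c / a))
  calc Metric.infDist (p i (k + 1) ω) X ^ 2
      ≤ c * meanViolation J g π i (p i (k + 1) ω) := herr i _ (hpX₀ i k ω)
    _ = c / a * (a * meanViolation J g π i (p i (k + 1) ω)) := by field_simp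
    _ ≤ _ := by
        gcongr
        exact Finset.single_le_sum (f := fun i => a * meanViolation J g π i (p i (k + 1) ω))
          (fun i _ => hmv i _) (Finset.mem_univ i)

/-! ### The problem data -/

section ProblemData

variable {n N : ℕ} {ι : Type*} {X₀ : Set (Vec n)} {J : Fin N → Finset ι}
  {Uf : Fin N → Set (Vec n)} {f : Fin N → Vec n → ℝ} {Ug : ι → Set (Vec n)} {g : ι → Vec n → ℝ}

theorem feasible_eq_inter (X₀ : Set (Vec n)) (J : Fin N → Finset ι) (g : ι → Vec n → ℝ) :
    feasible X₀ J g = X₀ ∩ ⋂ i, ⋂ j ∈ J i, {x ∈ X₀ | g j x ≤ 0} := by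
  ext x
  simp only [feasible, Set.mem_ofPred_eq, Set.mem_inter_iff, Set.mem_iInter]
  exact ⟨fun h => ⟨h.1, fun i j hj => ⟨h.1, h.2 i j hj⟩⟩,
    fun h => ⟨h.1, fun i j hj => (h.2 i j hj).2⟩⟩

theorem ConvexData.isClosed_feasible (h : ConvexData X₀ J Uf f Ug g) :
    IsClosed (feasible X₀ J g) := by
  rw [feasible_eq_inter]
  exact h.closed.inter (isClosed_iInter fun i => isClosed_iInter fun j => isClosed_iInter fun hj =>
    (((h.g_convex i j hj).continuousOn (h.g_open i j hj)).mono
      (h.g_subset i j hj)).preimage_isClosed_of_isClosed h.closed isClosed_Iic)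

theorem ConvexData.convex_feasible (h : ConvexData X₀ J Uf f Ug g) :
    Convex ℝ (feasible X₀ J g) := by
  rw [feasible_eq_inter]
  exact h.convex.inter (convex_iInter fun i => convex_iInter fun j => convex_iInter fun hj =>
    ((h.g_convex i j hj).subset (h.g_subset i j hj) h.convex).convex_le 0)

theorem ConvexData.continuousOn_f (h : ConvexData X₀ J Uf f Ug g) (i : Fin N) :
    ContinuousOn (f i) X₀ :=
  ((h.f_convex i).continuousOn (h.f_open i)).mono (h.f_subset i)

theorem ConvexData.isClosed_optimal (h : ConvexData X₀ J Uf f Ug g) :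
    IsClosed (optimal X₀ J g f) := by
  rcases (optimal X₀ J g f).eq_empty_or_nonempty with he | ⟨y, hyX, hy⟩
  · rw [he]; exact isClosed_empty
  have : optimal X₀ J g f = feasible X₀ J g ∩
      (fun u => ∑ i, f i u) ⁻¹' Set.Iic (∑ i, f i y) := by
    ext u
    exact ⟨fun hu => ⟨hu.1, hu.2 y hyX⟩, fun hu => ⟨hu.1, fun w hw => hu.2.trans (hy w hw)⟩⟩
  rw [this]
  exact ContinuousOn.preimage_isClosed_of_isClosed (continuousOn_finsetSum _ fun i _ =>
    (h.continuousOn_f i).mono fun _ hu => hu.1) h.isClosed_feasible isClosed_Iic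

/-- A common bound for the subgradients of all objectives. -/
theorem ConvexData.exists_f_bound (h : ConvexData X₀ J Uf f Ug g) :
    ∃ C : ℝ, 0 ≤ C ∧ ∀ i, ∀ u ∈ X₀, ∀ s ∈ subdiff (Uf i) (f i) u, ‖s‖ ≤ C := by
  choose C hC using h.f_bounded
  exact ⟨∑ i, |C i|, Finset.sum_nonneg fun _ _ => abs_nonneg _, fun i u hu s hs =>
    ((hC i u hu s hs).trans (le_abs_self _)).trans
      (Finset.single_le_sum (f := fun i => |C i|) (fun _ _ => abs_nonneg _) (Finset.mem_univ i))⟩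

end ProblemData

/-- A common constant for the error bounds of all agents. -/
theorem ErrorBound.exists_uniform {n N : ℕ} {ι : Type*} {X₀ : Set (Vec n)} {J : Fin N → Finset ι}
    {g : ι → Vec n → ℝ} {π : Fin N → PMF ι} (h : ErrorBound X₀ J g π) :
    ∃ c : ℝ, 0 < c ∧ ∀ i, ∀ u ∈ X₀,
      Metric.infDist u (feasible X₀ J g) ^ 2 ≤ c * meanViolation J g π i u := by
  choose c hc0 hc using h
  refine ⟨1 + ∑ i, c i, add_pos_of_pos_of_nonneg one_pos (Finset.sum_nonneg fun i _ => (hc0 i).le),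
    fun i u hu => (hc i u hu).trans ?_⟩
  refine mul_le_mul_of_nonneg_right ?_ (meanViolation_nonneg J g π i u)
  have := Finset.single_le_sum (f := c) (fun i _ => (hc0 i).le) (Finset.mem_univ i)
  linarith

end DAP

theorem proposition1 {n N : ℕ} {ι Ω : Type*}
    [MeasurableSpace ι] [MeasurableSingletonClass ι]
    [mΩ : MeasurableSpace Ω] (P : Measure Ω) [IsProbabilityMeasure P]
    (ℱ : Filtration ℕ mΩ)
    (X₀ : Set (DAP.Vec n)) (J : Fin N → Finset ι)
    (Uf : Fin N → Set (DAP.Vec n)) (f : Fin N → DAP.Vec n → ℝ)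
    (Ug : ι → Set (DAP.Vec n)) (g : ι → DAP.Vec n → ℝ)
    (π : Fin N → PMF ι)
    (G : ℕ → Digraph (Fin N)) (W : ℕ → Matrix (Fin N) (Fin N) ℝ) (α : ℕ → ℝ)
    (idx : Fin N → ℕ → Ω → ι) (x p v s d : Fin N → ℕ → Ω → DAP.Vec n)
    (hopt : (DAP.optimal X₀ J g f).Nonempty)
    (hW : DAP.DoublyStochasticWeights G W)
    (hconv : DAP.ConvexData X₀ J Uf f Ug g)
    (hsamp : DAP.Sampling P ℱ J π idx)
    (herr : DAP.ErrorBound X₀ J g π)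
    (hconn : DAP.QStronglyConnected G)
    (hα : DAP.Stepsizes α)
    (hrun : DAP.IsRun ℱ X₀ Uf f Ug g W α idx x p v s d) :
    ∃ xstar : Ω → DAP.Vec n, Measurable xstar ∧
      (∀ ω, xstar ω ∈ DAP.optimal X₀ J g f) ∧
      ∀ᵐ ω ∂P, ∀ i, Tendsto (fun k => x i k ω) atTop (𝓝 (xstar ω)) := by
  classical
  obtain ⟨y₀, hy₀⟩ := hopt
  rcases Nat.eq_zero_or_pos N with rfl | hN
  · exact ⟨fun _ => y₀, measurable_const, fun _ => hy₀, ae_of_all _ fun _ i => i.elim0⟩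
  have : NeZero N := ⟨hN.ne'⟩
  have hcl := hconv.isClosed_feasible
  have hne : (DAP.feasible X₀ J g).Nonempty := ⟨y₀, hy₀.1⟩
  obtain ⟨C, hC0, hC⟩ := hconv.exists_f_bound
  obtain ⟨K', hK'⟩ := hconv.g_bounded
  obtain ⟨K, hKdef⟩ : ∃ K, K = max K' 1 := ⟨_, rfl⟩
  have hK0 : 0 < K := hKdef ▸ lt_max_of_lt_right one_pos
  have hK : ∀ i, ∀ j ∈ J i, ∀ u ∈ X₀, ∀ e ∈ DAP.subdiff (Ug j) (DAP.gplus g j) u, ‖e‖ ≤ K :=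
    fun i j hj u hu e he => (hK' i j hj u hu e he).trans (hKdef ▸ le_max_left _ _)
  obtain ⟨c, hc0, hc⟩ := herr.exists_uniform
  have hlip : ∀ i, ∀ u ∈ X₀, ∀ w ∈ X₀, f i u - f i w ≤ C * ‖u - w‖ := fun i u hu w hw =>
    DAP.sub_le_mul_norm_of_subdiff_bound (hconv.f_open i) (hconv.f_convex i)
      (hconv.f_subset i hu) (hconv.f_subset i hw) (hC i u hu)
  have hglip : ∀ i, ∀ j ∈ J i, ∀ u ∈ X₀, ∀ w ∈ X₀,
      DAP.gplus g j u - DAP.gplus g j w ≤ K * ‖u - w‖ := fun i j hj u hu w hw =>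
    DAP.sub_le_mul_norm_of_subdiff_bound (hconv.g_open i j hj)
      (DAP.gplus_convexOn (hconv.g_convex i j hj)) (hconv.g_subset i j hj hu)
      (hconv.g_subset i j hj hw) (hK i j hj u hu)
  have hgcont : ∀ i, ∀ j ∈ J i, ContinuousOn (DAP.gplus g j) X₀ := fun i j hj =>
    ((DAP.gplus_convexOn (hconv.g_convex i j hj)).continuousOn (hconv.g_open i j hj)).mono
      (hconv.g_subset i j hj)
  have hx : ∀ i k ω, x i k ω ∈ X₀ := fun i k ω => by
    cases k with
    | zero => exact hrun.init i ω
    | succ k => exact (hrun.approx_proj i k ω).1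
  have hpX₀ : ∀ i k ω, p i (k + 1) ω ∈ X₀ := fun i k ω => by
    rw [hrun.consensus]
    exact DAP.average_mem hW hconv.convex k i fun j => hx j k ω
  have hstep : ∀ i k ω, ∀ y ∈ DAP.feasible X₀ J g, ‖x i (k + 1) ω - y‖ ^ 2 ≤
      ‖p i (k + 1) ω - y‖ ^ 2 - 2 * α (k + 1) * (f i (p i (k + 1) ω) - f i y)
        + 2 * C ^ 2 * α (k + 1) ^ 2
        - 1 / (2 * K ^ 2) * DAP.gplus g (idx i (k + 1) ω) (p i (k + 1) ω) ^ 2 := by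
    intro i k ω y hy
    have hj := hsamp.mem i (k + 1) (by omega) ω
    have hv := hrun.descent i k ω
    exact DAP.norm_sub_sq_le_of_step hconv.convex (hα.nonneg _) hK0 (hpX₀ i k ω) hy.1
      (hconv.f_subset i hy.1) (hconv.g_subset i _ hj hy.1) (max_eq_right (hy.2 i _ hj))
      (hrun.subgrad_f i k ω) (hC i _ (hpX₀ i k ω) _ (hrun.subgrad_f i k ω)) hv
      (fun hpos => ⟨hrun.subgrad_g i k ω hpos, hK i _ hj _ hv.1 _ (hrun.subgrad_g i k ω hpos)⟩)
      (hglip i _ hj _ (hpX₀ i k ω) _ hv.1) (hrun.approx_proj i k ω)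
  have hae : ∀ᵐ ω ∂P, ∃ z ∈ DAP.optimal X₀ J g f,
      ∀ i, Tendsto (fun k => x i k ω) atTop (𝓝 z) := by
    filter_upwards [DAP.ae_summable_infDist_sq hW hα hsamp hconv.convex_feasible hcl hne hK0 hc0 hc
      hlip hglip hgcont hrun.adapted hrun.consensus hpX₀ hstep] with ω hω
    refine DAP.exists_tendsto_optimal (x := fun i k => x i k ω) (p := fun i k => p i k ω)
      ⟨y₀, hy₀⟩ hW hconn hα hconv.convex hcl hC0 hlip (fun i k => hx i k ω)
      (fun i k => hrun.consensus i k ω) (fun i k y hy => (hstep i k ω y hy).trans ?_) hω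
    exact sub_le_self _ (by positivity)
  have hxm : ∀ i k, Measurable (x i k) := fun i k => (hrun.adapted i k).mono (ℱ.le k) le_rfl
  obtain ⟨l, hlm, hl⟩ := measurable_limit_of_tendsto_metrizable_ae (μ := P)
    (f := fun k => x (0 : Fin N) k) (L := atTop) (fun k => (hxm 0 k).aemeasurable)
    (hae.mono fun ω ⟨z, _, hz⟩ => ⟨z, hz 0⟩)
  -- On the null set where the limit fails to be optimal it is replaced by a fixed optimal point.
  have hmeas : MeasurableSet (l ⁻¹' DAP.optimal X₀ J g f) :=
    hlm hconv.isClosed_optimal.measurableSet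
  refine ⟨(l ⁻¹' DAP.optimal X₀ J g f).piecewise l fun _ => y₀,
    hlm.piecewise hmeas measurable_const, fun ω => ?_, ?_⟩
  · by_cases hω : ω ∈ l ⁻¹' DAP.optimal X₀ J g f
    · rw [Set.piecewise_eq_of_mem _ _ _ hω]
      exact hω
    · rw [Set.piecewise_eq_of_notMem _ _ _ hω]
      exact hy₀
  · filter_upwards [hae, hl] with ω ⟨z, hzo, hz⟩ hlω
    have hlz : l ω = z := tendsto_nhds_unique hlω (hz 0)
    rw [Set.piecewise_eq_of_mem _ _ _ (show ω ∈ l ⁻¹' DAP.optimal X₀ J g f by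
      rw [Set.mem_preimage, hlz]; exact hzo), hlz]
    exact hz
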